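/- Let $\mathcal M_1(\mathbb R)$ be the set of Borel probability measures on $\mathbb R$ with the weak topology. For $n\in\mathbb N=\{1,2,\dots\}$ and $\theta\in\mathbb R^n$ let $\mu^{\mathrm{discr}}_{\theta}\in\mathcal M_1(\mathbb R)$ be the law of $\sum_{i=1}^n \theta_i V_i$, where $V_1,\dots,V_n$ are independent Rademacher random variables, $\mathbb P[V_i=1]=\mathbb P[V_i=-1]=\tfrac12$ (that is, $(V_1,\dots,V_n)$ is uniform on $\{-1,+1\}^n$). For every $n\in\mathbb N$ let $\Theta^{(n)}$ be a random vector uniformly distributed on the unit sphere $\mathbb S^{n-1}\subset\mathbb R^n$. For every non-increasing sequence $\alpha_1\ge\alpha_2\ge\dots\ge 0$ of reals with $\|\alpha\|_2^2:=\sum_{k\ge1}\alpha_k^2<1$ let $\nu(\alpha)\in\mathcal M_1(\mathbb R)$ be the law of $$\sqrt{1-\|\alpha\|_2^2}\;Z+\sum_{k=1}^\infty \alpha_k V_k ,$$ where $Z$ is standard Gaussian, $V_1,V_2,\dots$ are Rademacher, and $Z,V_1,V_2,\dots$ are independent; the series (the limit of its partial sums) converges almost surely. Then there is a well-defined function $I:\mathcal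 M_1(\mathbb R)\to[0,+\infty]$ with $$I(\nu(\alpha))=-\tfrac12\log\left(1-\|\alpha\|_2^2\right)$$ for every such $\alpha$, and $I(\nu)=+\infty$ for every $\nu\in\mathcal M_1(\mathbb R)$ that is not of the form $\nu(\alpha)$. It is a good rate function: it is lower semicontinuous and $\{\nu: I(\nu)\le a\}$ is compact for every finite $a\ge0$. The random measures $\mu^{\mathrm{discr}}_{\Theta^{(n)}}$, $n\in\mathbb N$, are Borel random elements of $\mathcal M_1(\mathbb R)$ and satisfy a large deviation principle on $\mathcal M_1(\mathbb R)$ at speed $n$ with rate function $I$: for every Borel set $A\subset\mathcal M_1(\mathbb R)$, with interior $A^\circ$ and closure $\overline A$, $$-\inf_{\nu\in A^\circ} I(\nu)\le\liminf_{n\to\infty}\frac1n\log\mathbb P\left[\mu^{\mathrm{discr}}_{\Theta^{(n)}}\in A\right]\le\limsup_{n\to\infty}\frac1n\log\mathbb P\left[\mu^{\mathrm{discr}}_{\Theta^{(n)}}\in A\right]\le-\inf_{\nu\in\overline A} I(\nu),$$ where $\log 0=-\infty$ and $\inf\emptyset=+\infty$. -/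

import Mathlib

open MeasureTheory ProbabilityTheory Filter Topology
open scoped ENNReal NNReal

noncomputable section

namespace CubeLDP

/-! ## Large deviation principles -/

/-- A sequence `(ξ n)_{n ≥ 1}` of random elements of a topological space `M`, with `ξ n` defined on
the probability space `(Ω n, P n)`, satisfies the (full) large deviation principle with speed `s`
and rate function `I : M → [0, ∞]`. Random elements are Borel measurable maps, Borel sets are the
sets of `borel M`, and the inequalities are between extended real numbers, with `log 0 = -∞` and
infima over the empty set equal to `+∞`. Entries with index `0` play no role. -/
structure SatisfiesLDP {M : Type*} [TopologicalSpace M] {Ω : ℕ → Type*}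
    [∀ n, MeasurableSpace (Ω n)] (P : ∀ n, Measure (Ω n)) (ξ : ∀ n, Ω n → M)
    (s : ℕ → ℝ) (I : M → ℝ≥0∞) : Prop where
  measurable : ∀ n, 1 ≤ n → Measurable[_, borel M] (ξ n)
  speed_pos : ∀ n, 1 ≤ n → 0 < s n
  speed_mono : ∀ m n, 1 ≤ m → m ≤ n → s m ≤ s n
  speed_tendsto : Tendsto s atTop atTop
  lowerSemicontinuous : LowerSemicontinuous I
  lower_bound : ∀ A : Set M, MeasurableSet[borel M] A →
    -(⨅ x ∈ interior A, (I x : EReal)) ≤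
      liminf (fun n => (((s n)⁻¹ : ℝ) : EReal) * ENNReal.log (P n (ξ n ⁻¹' A))) atTop
  upper_bound : ∀ A : Set M, MeasurableSet[borel M] A →
    limsup (fun n => (((s n)⁻¹ : ℝ) : EReal) * ENNReal.log (P n (ξ n ⁻¹' A))) atTop ≤
      -(⨅ x ∈ closure A, (I x : EReal))

/-- A rate function is good if its sublevel sets at all finite levels are compact. -/
def IsGoodRateFunction {M : Type*} [TopologicalSpace M] (I : M → ℝ≥0∞) : Prop :=
  ∀ a : ℝ≥0, IsCompact {x | I x ≤ (a : ℝ≥0∞)}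

/-! ## Uniform distribution on the sphere -/

/-- The uniform distribution on the unit sphere of `ℝⁿ` (for `n ≥ 1`), as a measure on `ℝⁿ`: the
normalized surface measure. -/
def uniformSphere (n : ℕ) : Measure (EuclideanSpace ℝ (Fin n)) :=
  let σ := (volume : Measure (EuclideanSpace ℝ (Fin n))).toSphere
  ((σ Set.univ)⁻¹ • σ).map Subtype.val

/-! ## Rademacher variables and projections of the discrete cube -/

/-- The Rademacher distribution: mass `1/2` at each of `1` and `-1`. -/
def rademacher : Measure ℝ :=
  (2⁻¹ : ℝ≥0∞) • (Measure.dirac 1 + Measure.dirac (-1))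

instance : IsProbabilityMeasure rademacher := by
  constructor
  simp only [rademacher, Measure.smul_apply, Measure.add_apply, measure_univ, smul_eq_mul]
  rw [one_add_one_eq_two]
  exact ENNReal.inv_mul_cancel (by norm_num) (by norm_num)

/-- The law of `⟨V, θ⟩ = ∑ i, V i * θ i`, where `V` is uniform on `{-1, 1}ⁿ`, i.e. has independent
Rademacher coordinates. -/
def discreteProjection {n : ℕ} (θ : EuclideanSpace ℝ (Fin n)) : ProbabilityMeasure ℝ :=
  ⟨(Measure.pi fun _ : Fin n => rademacher).map (fun v => ∑ i, v i * θ i),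
    Measure.isProbabilityMeasure_map (Measurable.aemeasurable (by fun_prop))⟩

/-! ## The limiting family of laws -/

/-- Nonincreasing sequences of nonnegative reals with `∑ α k ^ 2 < 1`. -/
structure Admissible (α : ℕ → ℝ) : Prop where
  antitone : Antitone α
  nonneg : ∀ k, 0 ≤ α k
  summable : Summable fun k => α k ^ 2
  tsum_lt_one : ∑' k, α k ^ 2 < 1

/-- The joint law of independent `Z, V 0, V 1, …` with `Z` standard Gaussian and all `V k`
Rademacher. -/
def jointLaw : Measure (ℝ × (ℕ → ℝ)) :=
  (gaussianReal 0 1).prod (Measure.infinitePi fun _ : ℕ => rademacher)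

instance : IsProbabilityMeasure jointLaw := by
  unfold jointLaw; infer_instance

/-- The partial sums of the series `∑ k, α k * V k`. -/
def partialSum (α : ℕ → ℝ) (m : ℕ) (v : ℕ → ℝ) : ℝ :=
  ∑ k ∈ Finset.range m, α k * v k

/-- The random variable `√(1 - ‖α‖²) Z + ∑ k, α k * V k`. The series is the limit of its partial
sums (it need not converge absolutely, so it is not a `tsum`). -/
def limitVariable (α : ℕ → ℝ) (ω : ℝ × (ℕ → ℝ)) : ℝ :=
  √(1 - ∑' k, α k ^ 2) * ω.1 + limUnder atTop (fun m => partialSum α m ω.2)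

lemma measurable_limitVariable (α : ℕ → ℝ) : Measurable (limitVariable α) := by
  have h : ∀ m, StronglyMeasurable (fun ω : ℝ × (ℕ → ℝ) => partialSum α m ω.2) := by
    intro m
    apply Measurable.stronglyMeasurable
    unfold partialSum
    fun_prop
  have h' : Measurable (fun ω : ℝ × (ℕ → ℝ) => limUnder atTop (fun m => partialSum α m ω.2)) :=
    (StronglyMeasurable.limUnder h).measurable
  unfold limitVariable
  fun_prop

/-- The law `ν(α)` of `√(1 - ‖α‖²) Z + ∑ k, α k * V k`. -/
def limitLaw (α : ℕ → ℝ) : ProbabilityMeasure ℝ :=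
  ⟨jointLaw.map (limitVariable α),
    Measure.isProbabilityMeasure_map (measurable_limitVariable α).aemeasurable⟩

end CubeLDP

end

noncomputable section

namespace CubeLDP

/-! ## Rademacher series -/

/-! The law of `∑ θ i * V i` depends on `θ` only through the sorted absolute values of its
coordinates, and for a unit vector it equals `ν` of that sequence, the Gaussian part being absent
(`limitLaw_sortAbs`). So everything happens on `unitSeq`, which is compact in the product topology
although the norm is not continuous there.

On `unitSeq` the map `limitLaw` is continuous: mass lost to infinity sits in coordinates that are
uniformly small, where `cos x` is close to `exp (-x ^ 2 / 2)`, so it reappears as Gaussian variance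
(`continuousOn_limitLaw`). It is injective: the first zero of the characteristic function reveals
the largest entry, which is divided out, and so on (`injOn_limitLaw`). Hence the rate is well
defined, and it remains to estimate probabilities for the sorted vector.

Both estimates write the uniform point as a normalized Gaussian vector. Upper bound: the `m` largest
squares add up to at least `s` with probability about `(1 - s) ^ (n / 2)`, by a union bound over
`m`-subsets and an exponential Markov inequality (`eventually_uniformSphere_sortAbs_le`);
compactness reduces any closed set to one such event. Lower bound: shift the Gaussian vector by `√n
α` and shrink its variance to `1 - ‖α‖²`; the change of measure costs `(1 - ‖α‖²) ^ (n / 2)`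
(`eventually_le_uniformSphere`). -/

lemma integral_rademacher {E : Type*} [NormedAddCommGroup E] [NormedSpace ℝ E] [CompleteSpace E]
    {f : ℝ → E} (hf : StronglyMeasurable f) :
    ∫ x, f x ∂rademacher = (2⁻¹ : ℝ) • (f 1 + f (-1)) := by
  unfold rademacher
  rw [integral_smul_measure, integral_add_measure (integrable_dirac' hf (by finiteness))
    (integrable_dirac' hf (by finiteness)), integral_dirac' _ _ hf, integral_dirac' _ _ hf]
  simp

lemma charFun_rademacher_map_mul (a t : ℝ) :
    charFun (rademacher.map (fun x => a * x)) t = ((Real.cos (a * t) : ℝ) : ℂ) := by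
  rw [charFun_apply_real, integral_map (by fun_prop) (by fun_prop),
    integral_rademacher (Measurable.stronglyMeasurable (by fun_prop)), Complex.ofReal_cos,
    Complex.cos]
  simp only [Complex.real_smul]
  push_cast
  rw [show (t : ℂ) * (a * 1) * Complex.I = a * t * Complex.I by ring,
    show (t : ℂ) * (a * -1) * Complex.I = -(a * t) * Complex.I by ring]
  ring

lemma iIndepFun_rademacher (α : ℕ → ℝ) :
    iIndepFun (fun k (v : ℕ → ℝ) => α k * v k) (Measure.infinitePi fun _ : ℕ => rademacher) :=
  iIndepFun_infinitePi (X := fun k x => α k * x) (by fun_prop)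

lemma map_eval_rademacher (α : ℕ → ℝ) (k : ℕ) :
    (Measure.infinitePi fun _ : ℕ => rademacher).map (fun v : ℕ → ℝ => α k * v k) =
      rademacher.map (fun x => α k * x) := by
  have h := (measurePreserving_eval_infinitePi (fun _ : ℕ => rademacher) k).map_eq
  conv_rhs => rw [← h]
  rw [Measure.map_map (by fun_prop) (by fun_prop)]
  rfl

lemma charFun_partialSum (α : ℕ → ℝ) (m : ℕ) (t : ℝ) :
    charFun ((Measure.infinitePi fun _ : ℕ => rademacher).map (partialSum α m)) t =
      ((∏ k ∈ Finset.range m, Real.cos (α k * t) : ℝ) : ℂ) := by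
  have h := ((iIndepFun_rademacher α).restrict (Finset.range m)).charFun_map_fun_finsetSum_eq_prod
    (by intro i _; exact Measurable.aemeasurable (by fun_prop))
  change charFun (Measure.map (fun v : ℕ → ℝ => ∑ k ∈ Finset.range m, α k * v k) _) t = _
  rw [h, Finset.prod_apply, Complex.ofReal_prod]
  refine Finset.prod_congr rfl fun k _ => ?_
  rw [map_eval_rademacher, charFun_rademacher_map_mul]

lemma memLp_coord (α : ℕ → ℝ) (k : ℕ) (p : ℝ≥0∞) :
    MemLp (fun v : ℕ → ℝ => α k * v k) p (Measure.infinitePi fun _ : ℕ => rademacher) := by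
  have h := measurePreserving_eval_infinitePi (fun _ : ℕ => rademacher) k
  have h2 : MemLp (fun x : ℝ => α k * x) p rademacher := by
    refine MemLp.of_bound (C := |α k|) (Measurable.aestronglyMeasurable (by fun_prop)) ?_
    unfold rademacher
    refine Measure.ae_smul_measure ?_ _
    rw [ae_add_measure_iff]
    constructor <;> rw [ae_dirac_iff (measurableSet_le (by fun_prop) (by fun_prop))] <;> simp
  exact h2.comp_measurePreserving h

lemma measurable_partialSum (α : ℕ → ℝ) (m : ℕ) : Measurable (partialSum α m) := by
  unfold partialSum; fun_prop

lemma integral_coord (α : ℕ → ℝ) (k : ℕ) :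
    ∫ v : ℕ → ℝ, α k * v k ∂(Measure.infinitePi fun _ : ℕ => rademacher) = 0 := by
  have h := measurePreserving_eval_infinitePi (fun _ : ℕ => rademacher) k
  have h1 : ∫ v : ℕ → ℝ, α k * v k ∂(Measure.infinitePi fun _ : ℕ => rademacher)
      = ∫ x, α k * x ∂rademacher := by
    conv_rhs => rw [← h.map_eq]
    rw [integral_map h.measurable.aemeasurable (by fun_prop)]
  rw [h1, integral_rademacher (Measurable.stronglyMeasurable (by fun_prop))]
  simp

lemma integral_coord_sq (α : ℕ → ℝ) (k : ℕ) :
    ∫ v : ℕ → ℝ, (α k * v k) ^ 2 ∂(Measure.infinitePi fun _ : ℕ => rademacher) = α k ^ 2 := by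
  have h := measurePreserving_eval_infinitePi (fun _ : ℕ => rademacher) k
  have h1 : ∫ v : ℕ → ℝ, (α k * v k) ^ 2 ∂(Measure.infinitePi fun _ : ℕ => rademacher)
      = ∫ x, (α k * x) ^ 2 ∂rademacher := by
    conv_rhs => rw [← h.map_eq]
    rw [integral_map h.measurable.aemeasurable (by fun_prop)]
  rw [h1, integral_rademacher (Measurable.stronglyMeasurable (by fun_prop))]
  simp only [smul_eq_mul]
  ring

lemma memLp_partialSum (α : ℕ → ℝ) (m : ℕ) (p : ℝ≥0∞) :
    MemLp (partialSum α m) p (Measure.infinitePi fun _ : ℕ => rademacher) :=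
  memLp_finsetSum _ fun k _ => memLp_coord α k p

lemma integral_partialSum (α : ℕ → ℝ) (m : ℕ) :
    ∫ v, partialSum α m v ∂(Measure.infinitePi fun _ : ℕ => rademacher) = 0 := by
  unfold partialSum
  rw [integral_finsetSum _ fun k _ => (memLp_coord α k 1).integrable le_rfl]
  simp [integral_coord]

lemma integral_partialSum_sq (α : ℕ → ℝ) (m : ℕ) :
    ∫ v, partialSum α m v ^ 2 ∂(Measure.infinitePi fun _ : ℕ => rademacher) =
      ∑ k ∈ Finset.range m, α k ^ 2 := by
  have hv := variance_of_integral_eq_zero (measurable_partialSum α m).aemeasurable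
    (integral_partialSum α m)
  rw [← hv]
  have h := IndepFun.variance_sum (μ := Measure.infinitePi fun _ : ℕ => rademacher)
    (X := fun k (v : ℕ → ℝ) => α k * v k) (s := Finset.range m)
    (fun k _ => memLp_coord α k 2)
    (fun i _ j _ hij => (iIndepFun_rademacher α).indepFun hij)
  have e : partialSum α m = ∑ k ∈ Finset.range m, fun v : ℕ → ℝ => α k * v k := by
    ext v; simp [partialSum]
  rw [e, h]
  refine Finset.sum_congr rfl fun k _ => ?_
  rw [variance_of_integral_eq_zero (memLp_coord α k 1).aestronglyMeasurable.aemeasurable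
    (integral_coord α k), integral_coord_sq]

/-- Kolmogorov's theorem for Rademacher series. -/
lemma ae_tendsto_partialSum {α : ℕ → ℝ} (hα : Summable fun k => α k ^ 2) :
    ∀ᵐ v ∂(Measure.infinitePi fun _ : ℕ => rademacher),
      ∃ x : ℝ, Tendsto (fun m => partialSum α m v) atTop (𝓝 x) := by
  set μ := Measure.infinitePi fun _ : ℕ => rademacher
  let X : ℕ → (ℕ → ℝ) → ℝ := fun k v => α k * v k
  have hX : ∀ k, StronglyMeasurable (X k) := fun k =>
    Measurable.stronglyMeasurable (by fun_prop)
  let 𝒢 := Filtration.natural X hX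
  -- The shift by one makes `f m` adapted: the natural filtration at time `m` already contains `X
  -- m`.
  let f : ℕ → (ℕ → ℝ) → ℝ := fun m => partialSum α (m + 1)
  have hmart : Martingale f 𝒢 μ := by
    refine martingale_of_condExp_sub_eq_zero_nat ?_ ?_ ?_
    · intro m
      have e : f m = ∑ k ∈ Finset.range (m + 1), X k := by ext v; simp [f, partialSum, X]
      rw [e]
      refine Finset.stronglyMeasurable_sum _ fun k hk => ?_
      exact (Filtration.stronglyAdapted_natural hX k).mono
        (𝒢.mono (Nat.lt_succ_iff.1 (Finset.mem_range.1 hk)))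
    · exact fun m => (memLp_partialSum α (m + 1) 1).integrable le_rfl
    · intro m
      have e : f (m + 1) - f m = X (m + 1) := by
        ext v; simp [f, partialSum, X, Finset.sum_range_succ _ (m + 1)]
      rw [e]
      refine ((iIndepFun_rademacher α).condExp_natural_ae_eq_of_lt hX (Nat.lt_succ_self m)).trans ?_
      exact Eventually.of_forall fun _ => integral_coord α (m + 1)
  -- Martingale convergence needs only an `L¹` bound; it follows from `|x| ≤ 1 + x ^ 2` and
  -- orthogonality of the terms.
  have hbdd : ∀ m, eLpNorm (f m) 1 μ ≤ ((1 + ∑' k, α k ^ 2).toNNReal : ℝ≥0∞) := by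
    intro m
    have hm := memLp_partialSum α (m + 1) 2
    rw [eLpNorm_one_eq_lintegral_enorm]
    have h1 : ∫⁻ v, ‖f m v‖ₑ ∂μ ≤ ∫⁻ v, ENNReal.ofReal (1 + partialSum α (m + 1) v ^ 2) ∂μ := by
      refine lintegral_mono fun v => ?_
      rw [← ofReal_norm]
      refine ENNReal.ofReal_le_ofReal ?_
      rw [Real.norm_eq_abs, ← sq_abs]
      change |f m v| ≤ 1 + |f m v| ^ 2
      nlinarith [sq_nonneg (|f m v| - 1), abs_nonneg (f m v)]
    refine h1.trans ?_
    have hi : Integrable (fun v => 1 + partialSum α (m + 1) v ^ 2) μ :=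
      (integrable_const _).add hm.integrable_sq
    rw [← ofReal_integral_eq_lintegral_ofReal hi
      (Eventually.of_forall fun v => add_nonneg zero_le_one (sq_nonneg _)),
      integral_add (integrable_const _) hm.integrable_sq, integral_partialSum_sq]
    refine ENNReal.ofReal_le_ofReal ?_
    simp only [integral_const, probReal_univ, smul_eq_mul, mul_one]
    gcongr
    exact hα.sum_le_tsum _ fun _ _ => sq_nonneg _
  filter_upwards [hmart.submartingale.ae_tendsto_limitProcess hbdd] with v hv
  exact ⟨_, (tendsto_add_atTop_iff_nat 1).1 hv⟩

lemma ae_tendsto_partialSum_jointLaw {α : ℕ → ℝ} (hα : Summable fun k => α k ^ 2) :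
    ∀ᵐ ω ∂jointLaw, ∃ x : ℝ, Tendsto (fun m => partialSum α m ω.2) atTop (𝓝 x) :=
  Measure.quasiMeasurePreserving_snd.ae (ae_tendsto_partialSum hα)

lemma tendsto_charFun_partialSum {α : ℕ → ℝ} (hα : Summable fun k => α k ^ 2) (t : ℝ) :
    Tendsto (fun m => ((∏ k ∈ Finset.range m, Real.cos (α k * t) : ℝ) : ℂ)) atTop
      (𝓝 (∫ v, Complex.exp (t * (limUnder atTop (fun m => partialSum α m v) : ℝ) * Complex.I)
        ∂(Measure.infinitePi fun _ : ℕ => rademacher))) := by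
  simp_rw [← charFun_partialSum]
  have e : ∀ m, charFun ((Measure.infinitePi fun _ : ℕ => rademacher).map (partialSum α m)) t =
      ∫ v, Complex.exp (t * (partialSum α m v : ℝ) * Complex.I)
        ∂(Measure.infinitePi fun _ : ℕ => rademacher) := by
    intro m
    rw [charFun_apply_real, integral_map (measurable_partialSum α m).aemeasurable (by fun_prop)]
  simp_rw [e]
  refine tendsto_integral_of_dominated_convergence (fun _ => 1) ?_ (integrable_const _) ?_ ?_
  · intro m
    have := measurable_partialSum α m
    exact Measurable.aestronglyMeasurable (by fun_prop)
  · intro m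
    refine Eventually.of_forall fun v => ?_
    rw [← Complex.ofReal_mul, Complex.norm_exp_ofReal_mul_I]
  · filter_upwards [ae_tendsto_partialSum hα] with v hv
    have h := tendsto_nhds_limUnder hv
    exact (((Complex.continuous_ofReal.tendsto _).comp h).const_mul _ |>.mul_const _).cexp

/-- Total mass exactly `1` is allowed because sorted unit vectors lie there; the Gaussian factor is
then trivial. -/
lemma tendsto_charFun_limitLaw {α : ℕ → ℝ} (hα : Summable fun k => α k ^ 2)
    (h1 : ∑' k, α k ^ 2 ≤ 1) (t : ℝ) :
    Tendsto (fun m => ((Real.exp (-((1 - ∑' k, α k ^ 2) * t ^ 2 / 2)) *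
      ∏ k ∈ Finset.range m, Real.cos (α k * t) : ℝ) : ℂ)) atTop
      (𝓝 (charFun (limitLaw α : Measure ℝ) t)) := by
  have e : charFun (limitLaw α : Measure ℝ) t = Complex.exp (-((1 - ∑' k, α k ^ 2 : ℝ) * t ^ 2 / 2))
      * ∫ v, Complex.exp (t * (limUnder atTop (fun m => partialSum α m v) : ℝ) * Complex.I)
        ∂(Measure.infinitePi fun _ : ℕ => rademacher) := by
    change charFun (jointLaw.map (limitVariable α)) t = _
    rw [charFun_apply_real, integral_map (measurable_limitVariable α).aemeasurable (by fun_prop)]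
    have e1 : ∀ ω, Complex.exp (t * (limitVariable α ω : ℝ) * Complex.I) =
        Complex.exp ((t * √(1 - ∑' k, α k ^ 2) : ℝ) * ω.1 * Complex.I) *
        Complex.exp (t * (limUnder atTop (fun m => partialSum α m ω.2) : ℝ) * Complex.I) := by
      intro ω
      rw [← Complex.exp_add]
      congr 1
      simp only [limitVariable]
      push_cast
      ring
    simp_rw [e1]
    unfold jointLaw
    rw [integral_prod_mul (fun x : ℝ =>
        Complex.exp ((t * √(1 - ∑' k, α k ^ 2) : ℝ) * x * Complex.I))
      (fun v => Complex.exp (t * (limUnder atTop (fun m => partialSum α m v) : ℝ) * Complex.I)),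
      ← charFun_apply_real, charFun_gaussianReal]
    congr 2
    have hs : ((√(1 - ∑' k, α k ^ 2) : ℝ) : ℂ) ^ 2 = ((1 - ∑' k, α k ^ 2 : ℝ) : ℂ) := by
      rw [← Complex.ofReal_pow, Real.sq_sqrt (by linarith)]
    rw [Complex.ofReal_mul, mul_pow, hs]
    push_cast
    ring
  rw [e]
  have := (tendsto_charFun_partialSum hα t).const_mul
    (Complex.exp (-((1 - ∑' k, α k ^ 2 : ℝ) * t ^ 2 / 2)))
  refine this.congr fun m => ?_
  push_cast
  rfl

lemma charFun_discreteProjection {n : ℕ} (θ : EuclideanSpace ℝ (Fin n)) (t : ℝ) :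
    charFun (discreteProjection θ : Measure ℝ) t = ((∏ i, Real.cos (θ i * t) : ℝ) : ℂ) := by
  have hX : iIndepFun (fun (i : Fin n) (v : Fin n → ℝ) => v i * θ i)
      (Measure.pi fun _ : Fin n => rademacher) :=
    iIndepFun_pi (X := fun i x => x * θ i) (by fun_prop)
  have h := hX.charFun_map_fun_sum_eq_prod fun i => Measurable.aemeasurable (by fun_prop)
  change charFun (Measure.map (fun v : Fin n → ℝ => ∑ i, v i * θ i) _) t = _
  rw [h, Finset.prod_apply, Complex.ofReal_prod]
  refine Finset.prod_congr rfl fun i _ => ?_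
  rw [← charFun_rademacher_map_mul]
  have h := (measurePreserving_eval (fun _ : Fin n => rademacher) i).map_eq
  conv_rhs => rw [← h]
  rw [Measure.map_map (by fun_prop) (by fun_prop)]
  congr 2
  ext v
  simp [mul_comm]

/-! ## The compact set of nonincreasing sequences in the unit ball -/

/-- The nonincreasing sequences of nonnegative reals in the closed unit ball of `ℓ²`. -/
def unitSeq : Set (ℕ → ℝ) :=
  {α | Antitone α ∧ (∀ k, 0 ≤ α k) ∧ ∀ m, ∑ k ∈ Finset.range m, α k ^ 2 ≤ 1}

lemma unitSeq_summable {α : ℕ → ℝ} (hα : α ∈ unitSeq) : Summable fun k => α k ^ 2 :=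
  summable_of_sum_range_le (fun _ => sq_nonneg _) hα.2.2

lemma unitSeq_tsum_le {α : ℕ → ℝ} (hα : α ∈ unitSeq) : ∑' k, α k ^ 2 ≤ 1 :=
  Real.tsum_le_of_sum_range_le (fun _ => sq_nonneg _) hα.2.2

lemma Admissible.mem_unitSeq {α : ℕ → ℝ} (hα : Admissible α) : α ∈ unitSeq :=
  ⟨hα.antitone, hα.nonneg, fun _ =>
    (hα.summable.sum_le_tsum _ fun _ _ => sq_nonneg _).trans hα.tsum_lt_one.le⟩

lemma admissible_of_mem_unitSeq {α : ℕ → ℝ} (hα : α ∈ unitSeq) (h : ∑' k, α k ^ 2 < 1) :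
    Admissible α :=
  ⟨hα.1, hα.2.1, unitSeq_summable hα, h⟩

/-- The first `k + 1` squares are all at least `α k ^ 2` and sum to at most `1`. This decay, uniform
over `unitSeq`, drives the continuity of `limitLaw`. -/
lemma unitSeq_sq_le {α : ℕ → ℝ} (hα : α ∈ unitSeq) (k : ℕ) : α k ^ 2 ≤ 1 / ((k : ℝ) + 1) := by
  rw [le_div_iff₀ (by positivity)]
  have h : ∑ j ∈ Finset.range (k + 1), α k ^ 2 ≤ ∑ j ∈ Finset.range (k + 1), α j ^ 2 := by
    refine Finset.sum_le_sum fun j hj => ?_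
    exact pow_le_pow_left₀ (hα.2.1 k) (hα.1 (Nat.lt_succ_iff.1 (Finset.mem_range.1 hj))) 2
  simp only [Finset.sum_const, Finset.card_range, nsmul_eq_mul, Nat.cast_add, Nat.cast_one] at h
  linarith [hα.2.2 (k + 1)]

/-- Bounding partial sums instead of the full sum makes every condition closed in finitely many
coordinates. -/
lemma isClosed_unitSeq : IsClosed unitSeq := by
  have e : unitSeq = (⋂ i, ⋂ j, ⋂ (_ : i ≤ j), {α : ℕ → ℝ | α j ≤ α i}) ∩
      ((⋂ k, {α : ℕ → ℝ | 0 ≤ α k}) ∩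
        ⋂ m, {α : ℕ → ℝ | ∑ k ∈ Finset.range m, α k ^ 2 ≤ 1}) := by
    ext α
    simp [unitSeq, Antitone]
  rw [e]
  refine IsClosed.inter ?_ (IsClosed.inter ?_ ?_)
  · exact isClosed_iInter fun i => isClosed_iInter fun j => isClosed_iInter fun _ =>
      isClosed_le (by fun_prop) (by fun_prop)
  · exact isClosed_iInter fun k => isClosed_le (by fun_prop) (by fun_prop)
  · exact isClosed_iInter fun m => isClosed_le (by fun_prop) (by fun_prop)

lemma isCompact_unitSeq : IsCompact unitSeq := by
  refine (isCompact_univ_pi fun _ : ℕ => isCompact_Icc (a := (0 : ℝ)) (b := 1)).of_isClosed_subset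
    isClosed_unitSeq fun α hα k _ => ⟨hα.2.1 k, ?_⟩
  have h := unitSeq_sq_le hα k
  have h2 : 1 / ((k : ℝ) + 1) ≤ 1 := by
    rw [div_le_one (by positivity)]; linarith [(Nat.cast_nonneg k : (0 : ℝ) ≤ k)]
  nlinarith [hα.2.1 k]

/-! ## Characteristic functions of the limit laws -/

/-- The characteristic function of the limit law of a sequence truncated to its first `m` terms. -/
def truncCharFun (t : ℝ) (m : ℕ) (α : ℕ → ℝ) : ℝ :=
  Real.exp (-((1 - ∑ k ∈ Finset.range m, α k ^ 2) * t ^ 2 / 2)) *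
    ∏ k ∈ Finset.range m, Real.cos (α k * t)

/-- Both functions agree to second order at `0`; for `|x| > 1` the crude bound by `2` suffices. -/
lemma abs_cos_sub_exp_le (x : ℝ) : |Real.cos x - Real.exp (-(x ^ 2 / 2))| ≤ 2 * x ^ 4 := by
  rcases le_or_gt |x| 1 with hx | hx
  · have h1 := Real.cos_bound hx
    have hx2 : x ^ 2 ≤ 1 := by rw [← sq_abs]; nlinarith [abs_nonneg x]
    have h2 := Real.abs_exp_sub_one_sub_id_le (x := -(x ^ 2 / 2))
      (by rw [abs_neg, abs_of_nonneg (by positivity)]; linarith)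
    have h4 : |x| ^ 4 = x ^ 4 := by rw [show (4 : ℕ) = 2 * 2 from rfl, pow_mul, pow_mul, sq_abs]
    rw [h4] at h1
    rw [abs_le] at *
    have : 0 ≤ x ^ 4 := by positivity
    constructor <;> nlinarith [h1.1, h1.2, h2.1, h2.2]
  · have h1 := Real.abs_cos_le_one x
    have h2 : Real.exp (-(x ^ 2 / 2)) ≤ 1 := Real.exp_le_one_iff.2 (by nlinarith [sq_nonneg x])
    have h3 := Real.exp_pos (-(x ^ 2 / 2))
    have hx2 : 1 ≤ x ^ 2 := by rw [← sq_abs]; nlinarith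
    have hx4 : 1 ≤ x ^ 4 := by nlinarith
    rw [abs_le] at *
    constructor <;> linarith [h1.1, h1.2]

/-- Passing from `m` to `m + 1` only replaces the factor `exp (-x ^ 2 / 2)` by `cos x` at `x = α m *
t`. The error is of order `x ^ 4`, hence summable in `m` uniformly over `unitSeq`. -/
lemma abs_truncCharFun_succ_sub_le {α : ℕ → ℝ} (hα : α ∈ unitSeq) (t : ℝ) (m : ℕ) :
    |truncCharFun t (m + 1) α - truncCharFun t m α| ≤ 2 * t ^ 4 * (1 / ((m : ℝ) + 1) ^ 2) := by
  have e : truncCharFun t (m + 1) α - truncCharFun t m α =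
      Real.exp (-((1 - ∑ k ∈ Finset.range (m + 1), α k ^ 2) * t ^ 2 / 2)) *
      (∏ k ∈ Finset.range m, Real.cos (α k * t)) *
      (Real.cos (α m * t) - Real.exp (-((α m * t) ^ 2 / 2))) := by
    have h : Real.exp (-((1 - ∑ k ∈ Finset.range m, α k ^ 2) * t ^ 2 / 2)) =
        Real.exp (-((1 - ∑ k ∈ Finset.range (m + 1), α k ^ 2) * t ^ 2 / 2)) *
        Real.exp (-((α m * t) ^ 2 / 2)) := by
      rw [← Real.exp_add, Finset.sum_range_succ]
      congr 1
      ring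
    unfold truncCharFun
    rw [h, Finset.prod_range_succ]
    ring
  rw [e, abs_mul, abs_mul, Finset.abs_prod, abs_of_pos (Real.exp_pos _)]
  have h1 : Real.exp (-((1 - ∑ k ∈ Finset.range (m + 1), α k ^ 2) * t ^ 2 / 2)) ≤ 1 := by
    rw [Real.exp_le_one_iff]
    nlinarith [hα.2.2 (m + 1), sq_nonneg t]
  have h2 : ∏ k ∈ Finset.range m, |Real.cos (α k * t)| ≤ 1 :=
    Finset.prod_le_one (fun _ _ => abs_nonneg _) fun _ _ => Real.abs_cos_le_one _
  have h20 : 0 ≤ ∏ k ∈ Finset.range m, |Real.cos (α k * t)| :=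
    Finset.prod_nonneg fun _ _ => abs_nonneg _
  have h3 := abs_cos_sub_exp_le (α m * t)
  have h4 : (α m * t) ^ 4 ≤ t ^ 4 * (1 / ((m : ℝ) + 1) ^ 2) := by
    have h := unitSeq_sq_le hα m
    have h' : (α m ^ 2) ^ 2 ≤ (1 / ((m : ℝ) + 1)) ^ 2 := pow_le_pow_left₀ (sq_nonneg _) h 2
    have ht : 0 ≤ t ^ 4 := by positivity
    calc (α m * t) ^ 4 = t ^ 4 * (α m ^ 2) ^ 2 := by ring
      _ ≤ t ^ 4 * (1 / ((m : ℝ) + 1)) ^ 2 := by gcongr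
      _ = _ := by rw [div_pow, one_pow]
  calc _ ≤ 1 * 1 * (2 * (α m * t) ^ 4) := by gcongr
    _ ≤ _ := by linarith

lemma summable_bound (t : ℝ) : Summable fun m : ℕ => 2 * t ^ 4 * (1 / ((m : ℝ) + 1) ^ 2) := by
  refine Summable.mul_left _ ?_
  have h := (summable_nat_add_iff 1).2 (Real.summable_one_div_nat_pow.2 (one_lt_two))
  simpa using h

lemma tendsto_truncCharFun {α : ℕ → ℝ} (hα : α ∈ unitSeq) (t : ℝ) :
    Tendsto (fun m => ((truncCharFun t m α : ℝ) : ℂ)) atTop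
      (𝓝 (charFun (limitLaw α : Measure ℝ) t)) := by
  have h := tendsto_charFun_limitLaw (unitSeq_summable hα) (unitSeq_tsum_le hα) t
  have h2 : Tendsto (fun m => Real.exp (((∑ k ∈ Finset.range m, α k ^ 2) - ∑' k, α k ^ 2)
      * t ^ 2 / 2)) atTop (𝓝 1) := by
    have := (unitSeq_summable hα).hasSum.tendsto_sum_nat
    have h3 := (((this.sub_const (∑' k, α k ^ 2)).mul_const (t ^ 2)).div_const 2)
    have h4 := (Real.continuous_exp.tendsto _).comp h3
    simpa [Function.comp_def] using h4
  have h5 := ((Complex.continuous_ofReal.tendsto _).comp h2).mul h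
  rw [Complex.ofReal_one, one_mul] at h5
  refine h5.congr fun m => ?_
  simp only [Function.comp, ← Complex.ofReal_mul]
  unfold truncCharFun
  rw [← mul_assoc, ← Real.exp_add]
  congr 4
  ring

/-- The closed formula contains `∑' k, α k ^ 2`, which is discontinuous in the product topology; the
telescoped series has continuous terms and converges uniformly. -/
lemma charFun_limitLaw_eq_tsum {α : ℕ → ℝ} (hα : α ∈ unitSeq) (t : ℝ) :
    charFun (limitLaw α : Measure ℝ) t = ((truncCharFun t 0 α +
      ∑' m, (truncCharFun t (m + 1) α - truncCharFun t m α) : ℝ) : ℂ) := by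
  refine tendsto_nhds_unique (tendsto_truncCharFun hα t) ?_
  have hs : Summable fun m => truncCharFun t (m + 1) α - truncCharFun t m α :=
    Summable.of_norm_bounded (summable_bound t) fun m => abs_truncCharFun_succ_sub_le hα t m
  have h := (hs.hasSum.tendsto_sum_nat).const_add (truncCharFun t 0 α)
  refine ((Complex.continuous_ofReal.tendsto _).comp h).congr fun m => ?_
  simp only [Function.comp]
  rw [Finset.sum_range_sub (fun m => truncCharFun t m α), add_sub_cancel]

lemma continuousOn_charFun_limitLaw (t : ℝ) :
    ContinuousOn (fun α : ℕ → ℝ => charFun (limitLaw α : Measure ℝ) t) unitSeq := by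
  have hc : ∀ m, Continuous (truncCharFun t m) := fun m => by unfold truncCharFun; fun_prop
  have h : ContinuousOn (fun α : ℕ → ℝ => ((truncCharFun t 0 α +
      ∑' m, (truncCharFun t (m + 1) α - truncCharFun t m α) : ℝ) : ℂ)) unitSeq := by
    refine Complex.continuous_ofReal.comp_continuousOn ?_
    refine (hc 0).continuousOn.add ?_
    exact continuousOn_tsum (fun m => ((hc (m + 1)).sub (hc m)).continuousOn) (summable_bound t)
      fun m α hα => abs_truncCharFun_succ_sub_le hα t m
  exact h.congr fun α hα => charFun_limitLaw_eq_tsum hα t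

lemma continuousOn_limitLaw : ContinuousOn limitLaw unitSeq := by
  rw [continuousOn_iff_continuous_domRestrict]
  refine continuous_iff_seqContinuous.2 fun u a hu => ?_
  refine ProbabilityMeasure.tendsto_of_tendsto_charFun fun t => ?_
  exact (((continuousOn_iff_continuous_domRestrict.1 (continuousOn_charFun_limitLaw t)).tendsto a).comp
    hu)

lemma continuous_discreteProjection (n : ℕ) :
    Continuous (discreteProjection : EuclideanSpace ℝ (Fin n) → ProbabilityMeasure ℝ) := by
  refine continuous_iff_seqContinuous.2 fun u a hu => ?_
  refine ProbabilityMeasure.tendsto_of_tendsto_charFun fun t => ?_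
  simp_rw [Function.comp, charFun_discreteProjection]
  have hc : Continuous fun θ : EuclideanSpace ℝ (Fin n) =>
      ((∏ i, Real.cos (θ i * t) : ℝ) : ℂ) := by fun_prop
  exact (hc.tendsto a).comp hu

/-! ## Identifiability -/

/-- An infinite product of nonzero factors could still vanish; square summability keeps the tail
bounded below. -/
lemma charFun_limitLaw_ne_zero {α : ℕ → ℝ} (hα : α ∈ unitSeq) {t : ℝ}
    (ht : ∀ k, Real.cos (α k * t) ≠ 0) : charFun (limitLaw α : Measure ℝ) t ≠ 0 := by
  have hs := unitSeq_summable hα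
  have hev : ∀ᶠ k in atTop, (α k * t) ^ 2 ≤ 1 := by
    have h := (hs.tendsto_atTop_zero.mul_const (t ^ 2))
    rw [zero_mul] at h
    filter_upwards [h.eventually_le_const zero_lt_one] with k hk
    rwa [mul_pow]
  obtain ⟨M, hM⟩ := eventually_atTop.1 hev
  set c := Real.exp (-((1 - ∑' k, α k ^ 2) * t ^ 2 / 2)) *
    (|∏ k ∈ Finset.range M, Real.cos (α k * t)| * Real.exp (-t ^ 2))
  have hc : 0 < c := by
    have : 0 < |∏ k ∈ Finset.range M, Real.cos (α k * t)| :=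
      abs_pos.2 (Finset.prod_ne_zero_iff.2 fun k _ => ht k)
    positivity
  have hlim := (tendsto_charFun_limitLaw hs (unitSeq_tsum_le hα) t).norm
  have hle : c ≤ ‖charFun (limitLaw α : Measure ℝ) t‖ := by
    refine ge_of_tendsto hlim ?_
    filter_upwards [eventually_ge_atTop M] with m hm
    rw [Complex.norm_real, Real.norm_eq_abs, abs_mul, abs_of_pos (Real.exp_pos _)]
    refine mul_le_mul_of_nonneg_left ?_ (Real.exp_pos _).le
    rw [← Finset.prod_range_mul_prod_Ico _ hm, abs_mul]
    refine mul_le_mul_of_nonneg_left ?_ (abs_nonneg _)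
    refine le_trans ?_ (le_abs_self _)
    calc Real.exp (-t ^ 2) ≤ Real.exp (∑ k ∈ Finset.Ico M m, -(α k * t) ^ 2) := by
          rw [Real.exp_le_exp, Finset.sum_neg_distrib, neg_le_neg_iff]
          simp_rw [mul_pow]
          rw [← Finset.sum_mul]
          have h1 : ∑ k ∈ Finset.Ico M m, α k ^ 2 ≤ 1 := by
            refine le_trans ?_ (hα.2.2 m)
            refine Finset.sum_le_sum_of_subset_of_nonneg ?_ fun _ _ _ => sq_nonneg _
            intro k hk
            exact Finset.mem_range.2 (Finset.mem_Ico.1 hk).2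
          nlinarith [sq_nonneg t]
      _ = ∏ k ∈ Finset.Ico M m, Real.exp (-(α k * t) ^ 2) := Real.exp_sum _ _
      _ ≤ _ := by
          refine Finset.prod_le_prod (fun _ _ => (Real.exp_pos _).le) fun k hk => ?_
          have hk1 := hM k (Finset.mem_Ico.1 hk).1
          refine le_trans ?_ (Real.one_sub_sq_div_two_le_cos (x := α k * t))
          set y := (α k * t) ^ 2
          have hy : 0 ≤ y := sq_nonneg _
          -- For `0 ≤ y ≤ 1`: `exp (-y) ≤ 1 / (1 + y) ≤ 1 - y / 2`.
          have h3 := Real.add_one_le_exp y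
          rw [Real.exp_neg, inv_le_comm₀ (Real.exp_pos _) (by linarith)]
          refine le_trans ?_ h3
          rw [inv_le_iff_one_le_mul₀ (by linarith)]
          nlinarith
  intro h0
  rw [h0, norm_zero] at hle
  linarith

lemma unitSeq_shift {α : ℕ → ℝ} (hα : α ∈ unitSeq) (k : ℕ) : (fun j => α (j + k)) ∈ unitSeq := by
  refine ⟨fun i j hij => hα.1 (by omega), fun j => hα.2.1 _, fun m => ?_⟩
  refine le_trans ?_ (hα.2.2 (m + k))
  rw [← Finset.sum_range_add_sum_Ico _ (Nat.le_add_left k m), Finset.sum_Ico_eq_sum_range]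
  have : ∑ j ∈ Finset.range m, α (j + k) ^ 2 =
      ∑ j ∈ Finset.range (m + k - k), α (k + j) ^ 2 := by
    rw [Nat.add_sub_cancel]
    exact Finset.sum_congr rfl fun j _ => by rw [add_comm]
  rw [this]
  have : 0 ≤ ∑ j ∈ Finset.range k, α j ^ 2 := Finset.sum_nonneg fun _ _ => sq_nonneg _
  linarith

/-- Dropping `k` entries enlarges the Gaussian variance of the shifted law; the growing exponential
compensates for this. It allows a common initial segment to be divided out. -/
lemma charFun_limitLaw_shift {α : ℕ → ℝ} (hα : α ∈ unitSeq) (k : ℕ) (t : ℝ) :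
    charFun (limitLaw α : Measure ℝ) t =
      ((Real.exp ((∑ j ∈ Finset.range k, α j ^ 2) * t ^ 2 / 2) *
        ∏ j ∈ Finset.range k, Real.cos (α j * t) : ℝ) : ℂ) *
      charFun (limitLaw (fun j => α (j + k)) : Measure ℝ) t := by
  have h1 := (tendsto_add_atTop_iff_nat k).2 (tendsto_truncCharFun hα t)
  have h2 := (tendsto_truncCharFun (unitSeq_shift hα k) t).const_mul
    ((Real.exp ((∑ j ∈ Finset.range k, α j ^ 2) * t ^ 2 / 2) *
        ∏ j ∈ Finset.range k, Real.cos (α j * t) : ℝ) : ℂ)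
  refine tendsto_nhds_unique h1 (h2.congr fun m => ?_)
  rw [← Complex.ofReal_mul]
  unfold truncCharFun
  rw [add_comm m k, Finset.prod_range_add, Finset.sum_range_add]
  have e : ∀ j, α (j + k) = α (k + j) := fun j => by rw [add_comm]
  simp_rw [e]
  rw [mul_mul_mul_comm, ← Real.exp_add]
  congr 3
  ring

lemma eventually_cos_ne_zero {a : ℝ} (ha : a ≠ 0) (t₀ : ℝ) :
    ∀ᶠ t in 𝓝[≠] t₀, Real.cos (a * t) ≠ 0 := by
  by_cases h : Real.cos (a * t₀) = 0
  · have hd : HasDerivAt (fun t => Real.cos (a * t)) (-Real.sin (a * t₀) * a) t₀ := by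
      have := ((hasDerivAt_id t₀).const_mul a).cos
      simpa using this
    refine hd.eventually_ne ?_
    refine mul_ne_zero (neg_ne_zero.2 fun h2 => ?_) ha
    have := Real.sin_sq_add_cos_sq (a * t₀)
    rw [h, h2] at this
    norm_num at this
  · have hc : Continuous fun t => Real.cos (a * t) := by fun_prop
    exact (hc.continuousAt.eventually_ne h).filter_mono nhdsWithin_le_nhds

/-- After division by the common factors, the side with the larger entry `α k` vanishes at `π / (2 *
α k)`, while the cosines of the other side have arguments in `[0, π / 2)` there. -/
lemma not_lt_of_limitLaw_eq {α β : ℕ → ℝ} (hα : α ∈ unitSeq) (hβ : β ∈ unitSeq)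
    (h : limitLaw α = limitLaw β) {k : ℕ} (hk : ∀ j < k, α j = β j) : ¬ β k < α k := by
  intro hlt
  have hαk : 0 < α k := (hβ.2.1 k).trans_lt hlt
  set t₀ := Real.pi / (2 * α k)
  have ht₀ : α k * t₀ = Real.pi / 2 := by simp only [t₀]; field_simp
  have ht₀pos : 0 < t₀ := by positivity
  -- The common factors may vanish at `t₀` itself, but their zeros are isolated; divide nearby and
  -- return to `t₀` by continuity.
  have heq : ∀ᶠ t in 𝓝[≠] t₀, charFun (limitLaw (fun j => α (j + k)) : Measure ℝ) t =
      charFun (limitLaw (fun j => β (j + k)) : Measure ℝ) t := by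
    have hne : ∀ᶠ t in 𝓝[≠] t₀, ∀ j ∈ Finset.range k, Real.cos (α j * t) ≠ 0 := by
      rw [Filter.eventually_all_finset]
      intro j hj
      exact eventually_cos_ne_zero
        (hαk.trans_le (hα.1 (Finset.mem_range.1 hj).le)).ne' t₀
    filter_upwards [hne] with t ht
    have e1 := charFun_limitLaw_shift hα k t
    have e2 := charFun_limitLaw_shift hβ k t
    rw [← h] at e2
    have e3 : ∑ j ∈ Finset.range k, β j ^ 2 = ∑ j ∈ Finset.range k, α j ^ 2 :=
      Finset.sum_congr rfl fun j hj => by rw [hk j (Finset.mem_range.1 hj)]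
    have e4 : ∏ j ∈ Finset.range k, Real.cos (β j * t) =
        ∏ j ∈ Finset.range k, Real.cos (α j * t) :=
      Finset.prod_congr rfl fun j hj => by rw [hk j (Finset.mem_range.1 hj)]
    rw [e3, e4] at e2
    refine mul_left_cancel₀ ?_ (e1.symm.trans e2)
    rw [Complex.ofReal_ne_zero]
    exact mul_ne_zero (Real.exp_pos _).ne' (Finset.prod_ne_zero_iff.2 ht)
  have hcα : Continuous (charFun (limitLaw (fun j => α (j + k)) : Measure ℝ)) := by fun_prop
  have hcβ : Continuous (charFun (limitLaw (fun j => β (j + k)) : Measure ℝ)) := by fun_prop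
  have h0 : charFun (limitLaw (fun j => α (j + k)) : Measure ℝ) t₀ =
      charFun (limitLaw (fun j => β (j + k)) : Measure ℝ) t₀ := by
    refine tendsto_nhds_unique_of_eventuallyEq
      ((hcα.tendsto t₀).mono_left nhdsWithin_le_nhds)
      ((hcβ.tendsto t₀).mono_left nhdsWithin_le_nhds) heq
  have h1 : charFun (limitLaw (fun j => α (j + k)) : Measure ℝ) t₀ = 0 := by
    rw [charFun_limitLaw_shift (unitSeq_shift hα k) 1 t₀]
    simp [ht₀]
  refine charFun_limitLaw_ne_zero (unitSeq_shift hβ k) (t := t₀) (fun j => ?_) (h0.symm.trans h1)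
  refine (Real.cos_pos_of_mem_Ioo ⟨?_, ?_⟩).ne'
  · have : 0 ≤ β (j + k) * t₀ := mul_nonneg (hβ.2.1 _) ht₀pos.le
    linarith [Real.pi_pos]
  · rw [← ht₀]
    exact mul_lt_mul_of_pos_right ((hβ.1 (Nat.le_add_left k j)).trans_lt hlt) ht₀pos

lemma injOn_limitLaw : Set.InjOn limitLaw unitSeq := by
  intro α hα β hβ h
  funext k
  induction k using Nat.strong_induction_on with
  | _ k ih =>
    exact le_antisymm (not_lt.1 (not_lt_of_limitLaw_eq hα hβ h ih))
      (not_lt.1 (not_lt_of_limitLaw_eq hβ hα h.symm fun j hj => (ih j hj).symm))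

/-! ## Nonincreasing rearrangement -/

/-- A permutation that sorts the coordinates by nonincreasing absolute value. -/
def sortPerm {n : ℕ} (θ : EuclideanSpace ℝ (Fin n)) : Equiv.Perm (Fin n) :=
  Tuple.sort fun i => -|θ i|

/-- The nonincreasing rearrangement of the absolute values of the coordinates, padded by zeros. -/
def sortAbs {n : ℕ} (θ : EuclideanSpace ℝ (Fin n)) (k : ℕ) : ℝ :=
  if h : k < n then |θ (sortPerm θ ⟨k, h⟩)| else 0

section Rearrangement

variable {n : ℕ} (θ : EuclideanSpace ℝ (Fin n))

lemma sortAbs_fin (i : Fin n) : sortAbs θ i = |θ (sortPerm θ i)| := by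
  simp [sortAbs]

lemma sortAbs_nonneg (k : ℕ) : 0 ≤ sortAbs θ k := by
  unfold sortAbs; split_ifs <;> simp

lemma antitone_abs_sortPerm : Antitone fun i => |θ (sortPerm θ i)| := by
  intro i j hij
  have h := Tuple.monotone_sort (fun i => -|θ i|) hij
  exact neg_le_neg_iff.1 h

lemma antitone_sortAbs : Antitone (sortAbs θ) := by
  intro k l hkl
  by_cases hl : l < n
  · have hk : k < n := hkl.trans_lt hl
    simp only [sortAbs, hl, hk, dif_pos]
    exact antitone_abs_sortPerm θ (Fin.mk_le_mk.2 hkl)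
  · have : sortAbs θ l = 0 := by simp [sortAbs, hl]
    rw [this]
    exact sortAbs_nonneg θ k

/-- Replaces the order statistics by an unordered subset, ready for a union bound. -/
lemma sum_range_sortAbs_sq {m : ℕ} (hm : m ≤ n) :
    ∃ I ∈ Finset.powersetCard m (Finset.univ : Finset (Fin n)),
      ∑ k ∈ Finset.range m, sortAbs θ k ^ 2 = ∑ i ∈ I, θ i ^ 2 := by
  let e : Fin m ↪ Fin n := (Fin.castLEEmb hm).trans (sortPerm θ).toEmbedding
  refine ⟨Finset.univ.map e, ?_, ?_⟩
  · simp [Finset.mem_powersetCard]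
  · rw [Finset.sum_map, Finset.sum_range]
    refine Finset.sum_congr rfl fun i _ => ?_
    have := sortAbs_fin θ (Fin.castLE hm i)
    rw [Fin.val_castLE] at this
    rw [this, sq_abs]
    rfl

lemma sum_range_sortAbs_sq_of_le {m : ℕ} (hm : n ≤ m) :
    ∑ k ∈ Finset.range m, sortAbs θ k ^ 2 = ‖θ‖ ^ 2 := by
  have h : ∑ k ∈ Finset.range m, sortAbs θ k ^ 2 = ∑ k ∈ Finset.range n, sortAbs θ k ^ 2 := by
    refine (Finset.sum_subset (Finset.range_subset_range.2 hm) fun k _ hk => ?_).symm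
    simp [sortAbs, Finset.mem_range.not.1 hk]
  rw [h, Finset.sum_range, EuclideanSpace.real_norm_sq_eq]
  simp_rw [sortAbs_fin, sq_abs]
  exact Equiv.sum_comp (sortPerm θ) fun i => θ i ^ 2

variable {θ}

lemma sortAbs_mem_unitSeq (hθ : ‖θ‖ = 1) : sortAbs θ ∈ unitSeq := by
  refine ⟨antitone_sortAbs θ, sortAbs_nonneg θ, fun m => ?_⟩
  calc ∑ k ∈ Finset.range m, sortAbs θ k ^ 2 ≤ ∑ k ∈ Finset.range (max n m), sortAbs θ k ^ 2 :=
        Finset.sum_le_sum_of_subset_of_nonneg (Finset.range_subset_range.2 (le_max_right _ _))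
          fun _ _ _ => sq_nonneg _
    _ = 1 := by rw [sum_range_sortAbs_sq_of_le θ (le_max_left _ _), hθ, one_pow]

/-- The characteristic function is a symmetric product of even factors, padding zeros contribute
`cos 0 = 1`, and norm `1` leaves no Gaussian variance. -/
lemma limitLaw_sortAbs (hθ : ‖θ‖ = 1) : limitLaw (sortAbs θ) = discreteProjection θ := by
  suffices h : (limitLaw (sortAbs θ) : Measure ℝ) = (discreteProjection θ : Measure ℝ) from
    Subtype.ext h
  refine Measure.ext_of_charFun (funext fun t => ?_)
  refine tendsto_nhds_unique (tendsto_truncCharFun (sortAbs_mem_unitSeq hθ) t) ?_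
  rw [charFun_discreteProjection]
  refine tendsto_const_nhds.congr' ?_
  filter_upwards [eventually_ge_atTop n] with m hm
  unfold truncCharFun
  rw [sum_range_sortAbs_sq_of_le θ hm, hθ]
  have h : ∏ k ∈ Finset.range m, Real.cos (sortAbs θ k * t) =
      ∏ k ∈ Finset.range n, Real.cos (sortAbs θ k * t) := by
    refine (Finset.prod_subset (Finset.range_subset_range.2 hm) fun k _ hk => ?_).symm
    simp [sortAbs, Finset.mem_range.not.1 hk]
  have hc : ∀ x : ℝ, Real.cos (|x| * t) = Real.cos (x * t) := fun x => by
    rw [← Real.cos_abs, abs_mul, abs_abs, ← abs_mul, Real.cos_abs]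
  rw [h, Finset.prod_range]
  simp_rw [sortAbs_fin, hc]
  rw [Equiv.prod_comp (sortPerm θ) fun i => Real.cos (θ i * t)]
  simp

/-- Rearrangement does not increase the sup distance to a nonincreasing sequence. -/
lemma abs_sortAbs_sub_le {α : ℕ → ℝ} (hα : Antitone α) (hα0 : ∀ k, 0 ≤ α k) {δ : ℝ}
    (h : ∀ i : Fin n, |θ i - α i| ≤ δ) {k : ℕ} (hk : k < n) : |sortAbs θ k - α k| ≤ δ := by
  have h' : ∀ i : Fin n, |(|θ i| - α i)| ≤ δ := fun i => by
    refine le_trans ?_ (h i)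
    have := abs_abs_sub_abs_le_abs_sub (θ i) (α i)
    rwa [abs_of_nonneg (hα0 i)] at this
  let K : Fin n := ⟨k, hk⟩
  have hK : sortAbs θ k = |θ (sortPerm θ K)| := sortAbs_fin θ K
  -- Pigeonhole: `Iic K` and `Ici K` have `n + 1` elements together, so some index sits on one side
  -- of `K` before sorting and on the other side after.
  have hcount : ∀ s : Finset (Fin n), ∀ t : Finset (Fin n), n < s.card + t.card →
      ∃ i ∈ s, sortPerm θ i ∈ t := by
    intro s t hst
    by_contra hcon
    push Not at hcon
    have hd : Disjoint (s.map (sortPerm θ).toEmbedding) t := by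
      rw [Finset.disjoint_left]
      intro x hx hxt
      obtain ⟨i, hi, rfl⟩ := Finset.mem_map.1 hx
      exact hcon i hi hxt
    have := Finset.card_le_univ (s.map (sortPerm θ).toEmbedding ∪ t)
    rw [Finset.card_union_of_disjoint hd, Finset.card_map, Fintype.card_fin] at this
    omega
  rw [hK, abs_le]
  constructor
  · obtain ⟨i, hi, hi2⟩ := hcount (Finset.Ici K) (Finset.Iic K) (by
      simp only [Fin.card_Ici, Fin.card_Iic, K]; omega)
    have h1 := antitone_abs_sortPerm θ (Finset.mem_Ici.1 hi)
    have h2 : α k ≤ α (sortPerm θ i) := hα (Fin.le_def.1 (Finset.mem_Iic.1 hi2))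
    have h3 := (abs_le.1 (h' (sortPerm θ i))).1
    simp only at h1
    linarith
  · obtain ⟨i, hi, hi2⟩ := hcount (Finset.Iic K) (Finset.Ici K) (by
      simp only [Fin.card_Ici, Fin.card_Iic, K]; omega)
    have h1 := antitone_abs_sortPerm θ (Finset.mem_Iic.1 hi)
    have h2 : α (sortPerm θ i) ≤ α k := hα (Fin.le_def.1 (Finset.mem_Ici.1 hi2))
    have h3 := (abs_le.1 (h' (sortPerm θ i))).2
    simp only at h1
    linarith

end Rearrangement

/-! ## Product densities -/

lemma lintegral_pi_prod {n : ℕ} (μ : Fin n → Measure ℝ) [∀ i, SigmaFinite (μ i)]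
    (f : Fin n → ℝ → ℝ≥0∞) (hf : ∀ i, Measurable (f i)) :
    ∫⁻ x, ∏ i, f i (x i) ∂(Measure.pi μ) = ∏ i, ∫⁻ x, f i x ∂(μ i) := by
  induction n with
  | zero => simp
  | succ n ih =>
    have h := (measurePreserving_piFinSuccAbove μ 0).symm
    rw [← h.lintegral_comp_emb (MeasurableEquiv.measurableEmbedding _)]
    simp_rw [MeasurableEquiv.piFinSuccAbove_symm_apply, Fin.insertNthEquiv,
      Fin.prod_univ_succ, Fin.insertNth_zero, Equiv.coe_fn_mk, Fin.cons_succ,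
      Fin.zero_succAbove, Fin.cons_zero]
    rw [← ih (fun i => μ i.succ) (fun i => f i.succ) fun i => hf _]
    exact lintegral_prod_mul (μ := μ 0) (ν := Measure.pi fun i => μ i.succ) (f := f 0) (g := fun x : Fin n → ℝ => ∏ i, f i.succ (x i))
      (hf 0).aemeasurable
      (Finset.measurable_prod _ fun i _ => (hf _).comp (measurable_pi_apply i)).aemeasurable

lemma pi_withDensity {n : ℕ} (μ : Fin n → Measure ℝ) [∀ i, SigmaFinite (μ i)]
    (f : Fin n → ℝ → ℝ≥0∞) (hf : ∀ i, Measurable (f i))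
    [∀ i, SigmaFinite ((μ i).withDensity (f i))] :
    Measure.pi (fun i => (μ i).withDensity (f i)) =
      (Measure.pi μ).withDensity fun x => ∏ i, f i (x i) := by
  refine Measure.pi_eq fun s hs => ?_
  rw [withDensity_apply _ (MeasurableSet.univ_pi hs), ← lintegral_indicator (MeasurableSet.univ_pi hs)]
  have e : ∀ x : Fin n → ℝ, (Set.univ.pi s).indicator (fun x => ∏ i, f i (x i)) x =
      ∏ i, (s i).indicator (f i) (x i) := by
    intro x
    by_cases hx : x ∈ Set.univ.pi s
    · rw [Set.indicator_of_mem hx]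
      exact Finset.prod_congr rfl fun i _ => (Set.indicator_of_mem (hx i trivial) _).symm
    · rw [Set.indicator_of_notMem hx]
      obtain ⟨i, hi⟩ : ∃ i, x i ∉ s i := by simpa [Set.mem_pi] using hx
      exact (Finset.prod_eq_zero (Finset.mem_univ i) (Set.indicator_of_notMem hi _)).symm
  simp_rw [e]
  rw [lintegral_pi_prod μ _ fun i => (hf i).indicator (hs i)]
  refine Finset.prod_congr rfl fun i _ => ?_
  rw [withDensity_apply _ (hs i), lintegral_indicator (hs i)]

/-! ## The uniform distribution on the sphere as a normalized Gaussian vector -/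

/-- The law of `n` independent standard Gaussian variables. -/
def gaussianPi (n : ℕ) : Measure (Fin n → ℝ) := Measure.pi fun _ => gaussianReal 0 1

instance (n : ℕ) : IsProbabilityMeasure (gaussianPi n) := by
  unfold gaussianPi; infer_instance

lemma pi_gaussianReal_eq_withDensity {n : ℕ} (m : Fin n → ℝ) {v : ℝ≥0} (hv : v ≠ 0) :
    Measure.pi (fun i => gaussianReal (m i) v) =
      (volume : Measure (Fin n → ℝ)).withDensity fun x => ∏ i, gaussianPDF (m i) v (x i) := by
  have e : ∀ i, gaussianReal (m i) v = (volume : Measure ℝ).withDensity (gaussianPDF (m i) v) :=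
    fun i => gaussianReal_of_var_ne_zero _ hv
  have hs : ∀ i, SigmaFinite ((volume : Measure ℝ).withDensity (gaussianPDF (m i) v)) := fun i => by
    rw [← e]; infer_instance
  simp_rw [e]
  rw [pi_withDensity _ _ fun i => measurable_gaussianPDF _ _]
  rfl

lemma prod_gaussianPDF {n : ℕ} (m : Fin n → ℝ) (v : ℝ≥0) (x : Fin n → ℝ) :
    ∏ i, gaussianPDF (m i) v (x i) =
      ENNReal.ofReal ((√(2 * Real.pi * v))⁻¹ ^ n * Real.exp (-(∑ i, (x i - m i) ^ 2) / (2 * v))) := by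
  simp_rw [gaussianPDF]
  rw [← ENNReal.ofReal_prod_of_nonneg fun i _ => gaussianPDFReal_nonneg _ _ _]
  simp_rw [gaussianPDFReal]
  rw [Finset.prod_mul_distrib, Finset.prod_const, Finset.card_univ, Fintype.card_fin,
    ← Real.exp_sum, ← Finset.sum_div, Finset.sum_neg_distrib]

/-- The normalization of a vector. -/
def normalize {n : ℕ} (x : Fin n → ℝ) : EuclideanSpace ℝ (Fin n) :=
  ‖WithLp.toLp 2 x‖⁻¹ • WithLp.toLp 2 x

lemma measurable_normalize {n : ℕ} : Measurable (normalize (n := n)) := by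
  have : Measurable (WithLp.toLp 2 : (Fin n → ℝ) → EuclideanSpace ℝ (Fin n)) := by fun_prop
  unfold normalize
  exact this.norm.inv.smul this

/-- In polar coordinates the Gaussian density depends on the radius only, so the direction has law
proportional to surface measure; total mass fixes the constant. -/
lemma uniformSphere_eq_map_normalize {n : ℕ} (hn : 1 ≤ n) :
    uniformSphere n = (gaussianPi n).map normalize := by
  have : Nonempty (Fin n) := ⟨⟨0, hn⟩⟩
  let E := EuclideanSpace ℝ (Fin n)
  set σ := (volume : Measure E).toSphere
  let φ : ℝ → ℝ≥0∞ := fun r =>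
    ENNReal.ofReal ((√(2 * Real.pi * (1 : ℝ≥0)))⁻¹ ^ n * Real.exp (-r ^ 2 / (2 * (1 : ℝ≥0))))
  have hφ : Measurable φ := by fun_prop
  let ρ := Measure.volumeIoiPow (Module.finrank ℝ E - 1)
  set c := ∫⁻ r, φ (r : ℝ) ∂ρ
  have key : ∀ A : Set E, MeasurableSet A →
      (gaussianPi n).map normalize A = σ (Subtype.val ⁻¹' A) * c := by
    intro A hA
    have hA' : MeasurableSet (normalize ⁻¹' A : Set (Fin n → ℝ)) := measurable_normalize hA
    have hnorm : Measurable fun x : E => ‖x‖⁻¹ • x := measurable_norm.inv.smul measurable_id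
    let F : E → ℝ≥0∞ := fun x => A.indicator 1 (‖x‖⁻¹ • x) * φ ‖x‖
    have h1 : (gaussianPi n).map normalize A = ∫⁻ x : E, F x := by
      rw [Measure.map_apply measurable_normalize hA, gaussianPi,
        pi_gaussianReal_eq_withDensity _ one_ne_zero, withDensity_apply _ hA',
        ← lintegral_indicator hA', ← (PiLp.volume_preserving_toLp (Fin n)).lintegral_comp
          (f := F) (((measurable_one.indicator hA).comp hnorm).mul (hφ.comp measurable_norm))]
      refine lintegral_congr fun x => ?_
      have e : ∏ i, gaussianPDF 0 1 (x i) = φ ‖(WithLp.toLp 2 x : E)‖ := by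
        rw [prod_gaussianPDF (fun _ => 0)]
        simp only [φ, EuclideanSpace.real_norm_sq_eq, sub_zero]
      by_cases hx : normalize x ∈ A
      · rw [Set.indicator_of_mem (by exact hx), e]
        have hx' : ‖(WithLp.toLp 2 x : E)‖⁻¹ • (WithLp.toLp 2 x : E) ∈ A := hx
        simp only [F]
        rw [Set.indicator_of_mem hx', Pi.one_apply, one_mul]
      · rw [Set.indicator_of_notMem (by exact hx)]
        have hx' : ‖(WithLp.toLp 2 x : E)‖⁻¹ • (WithLp.toLp 2 x : E) ∉ A := hx
        simp only [F]
        rw [Set.indicator_of_notMem hx', zero_mul]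
    -- Polar coordinates need the origin removed; it is a null set because `1 ≤ n`.
    have h2 : ∫⁻ x : E, F x = ∫⁻ x : ({0}ᶜ : Set E), F x ∂((volume : Measure E).comap (↑)) := by
      rw [lintegral_subtype_comap (measurableSet_singleton _).compl]
      rw [Measure.restrict_congr_set (t := Set.univ), Measure.restrict_univ]
      rw [eventuallyEq_univ, mem_ae_iff, compl_compl]
      exact measure_singleton _
    let G : Metric.sphere (0 : E) 1 × Set.Ioi (0 : ℝ) → ℝ≥0∞ :=
      fun p => (Subtype.val ⁻¹' A).indicator 1 p.1 * φ (p.2 : ℝ)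
    have hG : Measurable G := by
      have hi : Measurable ((Subtype.val ⁻¹' A).indicator (1 : Metric.sphere (0 : E) 1 → ℝ≥0∞)) :=
        measurable_one.indicator (measurable_subtype_coe hA)
      exact (hi.comp measurable_fst).mul (hφ.comp (measurable_subtype_coe.comp measurable_snd))
    have h3 : ∀ x : ({0}ᶜ : Set E), F x = G (homeomorphUnitSphereProd E x) := by
      intro x
      have e1 := homeomorphUnitSphereProd_apply_fst_coe E x
      have e2 := homeomorphUnitSphereProd_apply_snd_coe E x
      simp only [F, G]
      rw [e2, ← e1]
      rfl
    rw [h1, h2]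
    simp_rw [h3]
    rw [(Measure.measurePreserving_homeomorphUnitSphereProd (volume : Measure E)).lintegral_comp hG]
    have h4 := lintegral_prod_mul (μ := σ) (ν := ρ)
      (f := (Subtype.val ⁻¹' A).indicator 1) (g := fun r => φ (r : ℝ))
      (measurable_one.indicator (measurable_subtype_coe hA)).aemeasurable
      (hφ.comp measurable_subtype_coe).aemeasurable
    rw [lintegral_indicator_one (measurable_subtype_coe hA)] at h4
    exact h4
  have huniv := key Set.univ .univ
  rw [Measure.map_apply measurable_normalize .univ, Set.preimage_univ, Set.preimage_univ,
    measure_univ] at huniv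
  have hc : c = (σ Set.univ)⁻¹ := ENNReal.eq_inv_of_mul_eq_one_left (by rw [mul_comm]; exact huniv.symm)
  ext A hA
  rw [key A hA, hc]
  change Measure.map Subtype.val ((σ Set.univ)⁻¹ • σ) A = _
  rw [Measure.map_apply measurable_subtype_coe hA, Measure.smul_apply, smul_eq_mul, mul_comm]

lemma normalize_apply {n : ℕ} (x : Fin n → ℝ) (i : Fin n) :
    normalize x i = x i / √(∑ j, x j ^ 2) := by
  simp [normalize, EuclideanSpace.norm_eq, div_eq_inv_mul]

lemma ae_norm_eq_one_uniformSphere {n : ℕ} : ∀ᵐ θ ∂(uniformSphere n), ‖θ‖ = 1 := by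
  unfold uniformSphere
  rw [ae_map_iff measurable_subtype_coe.aemeasurable
    (measurableSet_eq_fun measurable_norm measurable_const)]
  exact Eventually.of_forall fun x => by simp

/-! ## Upper bound for the largest coordinates of a point on the sphere -/

lemma lintegral_exp_mul_sq_gaussianReal {c : ℝ} (hc : 2 * c < 1) :
    ∫⁻ x, ENNReal.ofReal (Real.exp (c * x ^ 2)) ∂(gaussianReal 0 1) =
      ENNReal.ofReal (√(1 - 2 * c))⁻¹ := by
  have hpos : 0 < 1 - 2 * c := by linarith
  let v : ℝ≥0 := ⟨(1 - 2 * c)⁻¹, by positivity⟩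
  have hv : v ≠ 0 := by
    intro h
    have : (v : ℝ) = 0 := by rw [h]; rfl
    exact (inv_pos.2 hpos).ne' this
  have hv' : (v : ℝ) = (1 - 2 * c)⁻¹ := rfl
  rw [gaussianReal_of_var_ne_zero _ one_ne_zero,
    lintegral_withDensity_eq_lintegral_mul _ (measurable_gaussianPDF _ _) (by fun_prop)]
  have e : ∀ x, (gaussianPDF 0 1 * fun x => ENNReal.ofReal (Real.exp (c * x ^ 2))) x =
      ENNReal.ofReal (√(1 - 2 * c))⁻¹ * gaussianPDF 0 v x := by
    intro x
    simp only [Pi.mul_apply, gaussianPDF]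
    rw [← ENNReal.ofReal_mul (gaussianPDFReal_nonneg _ _ _), ← ENNReal.ofReal_mul (by positivity)]
    congr 1
    simp only [gaussianPDFReal, hv', NNReal.coe_one, mul_one, sub_zero]
    rw [mul_assoc, ← Real.exp_add, Real.sqrt_mul (by positivity) (1 - 2 * c)⁻¹, Real.sqrt_inv,
      mul_inv, inv_inv, ← mul_assoc]
    have h1 : √(1 - 2 * c) ≠ 0 := (Real.sqrt_pos.2 hpos).ne'
    congr 1
    · field_simp
    · congr 1
      field_simp
      ring
  simp_rw [e]
  rw [lintegral_const_mul _ (measurable_gaussianPDF _ _), lintegral_gaussianPDF_eq_one _ hv, mul_one]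

/-- Exponential Markov inequality for the form `l * (∑ i ∈ I, x i ^ 2 - s * ∑ j, x j ^ 2)`. It is
diagonal, so the expectation factors over coordinates; the event is homogeneous, so it also
describes the normalized vector. -/
lemma gaussianPi_sum_sq_le {n m : ℕ} {I : Finset (Fin n)}
    (hI : I ∈ Finset.powersetCard m Finset.univ) {s l : ℝ} (hl : 0 ≤ l) (hs : 0 ≤ s)
    (hls : 2 * (l * (1 - s)) < 1) :
    gaussianPi n {x | s * ∑ j, x j ^ 2 ≤ ∑ i ∈ I, x i ^ 2} ≤
      ENNReal.ofReal ((√(1 - 2 * (l * (1 - s))))⁻¹ ^ m * (√(1 + 2 * (l * s)))⁻¹ ^ (n - m)) := by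
  classical
  have hcard : I.card = m := (Finset.mem_powersetCard.1 hI).2
  let c : Fin n → ℝ := fun i => if i ∈ I then l * (1 - s) else -(l * s)
  have hc : ∀ i, 2 * c i < 1 := by
    intro i
    simp only [c]
    split_ifs
    · exact hls
    · have := mul_nonneg hl hs
      linarith
  have hsum : ∀ x : Fin n → ℝ, ∑ i, c i * x i ^ 2 =
      l * (∑ i ∈ I, x i ^ 2 - s * ∑ j, x j ^ 2) := by
    intro x
    have e : ∀ i, c i * x i ^ 2 = l * ((if i ∈ I then x i ^ 2 else 0) - s * x i ^ 2) := by
      intro i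
      simp only [c]
      split_ifs <;> ring
    simp_rw [e]
    rw [← Finset.mul_sum, Finset.sum_sub_distrib, ← Finset.mul_sum]
    simp
  have hmeas : MeasurableSet {x : Fin n → ℝ | s * ∑ j, x j ^ 2 ≤ ∑ i ∈ I, x i ^ 2} :=
    measurableSet_le (by fun_prop) (by fun_prop)
  calc gaussianPi n {x | s * ∑ j, x j ^ 2 ≤ ∑ i ∈ I, x i ^ 2}
      = ∫⁻ x, {x : Fin n → ℝ | s * ∑ j, x j ^ 2 ≤ ∑ i ∈ I, x i ^ 2}.indicator 1 x
          ∂(gaussianPi n) := (lintegral_indicator_one hmeas).symm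
    _ ≤ ∫⁻ x, ∏ i, ENNReal.ofReal (Real.exp (c i * x i ^ 2)) ∂(gaussianPi n) := by
        refine lintegral_mono fun x => ?_
        rw [← ENNReal.ofReal_prod_of_nonneg fun _ _ => (Real.exp_pos _).le, ← Real.exp_sum, hsum]
        by_cases hx : s * ∑ j, x j ^ 2 ≤ ∑ i ∈ I, x i ^ 2
        · rw [Set.indicator_of_mem (by exact hx), Pi.one_apply, ENNReal.one_le_ofReal,
            Real.one_le_exp_iff]
          exact mul_nonneg hl (by linarith)
        · rw [Set.indicator_of_notMem (by exact hx)]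
          exact zero_le
    _ = ∏ i, ENNReal.ofReal (√(1 - 2 * c i))⁻¹ := by
        unfold gaussianPi
        rw [lintegral_pi_prod _ (fun i x => ENNReal.ofReal (Real.exp (c i * x ^ 2))) (by fun_prop)]
        exact Finset.prod_congr rfl fun i _ => lintegral_exp_mul_sq_gaussianReal (hc i)
    _ = _ := by
        rw [← ENNReal.ofReal_prod_of_nonneg fun _ _ => by positivity]
        congr 1
        have e : ∀ i, (√(1 - 2 * c i))⁻¹ = if i ∈ I then (√(1 - 2 * (l * (1 - s))))⁻¹ else
            (√(1 + 2 * (l * s)))⁻¹ := by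
          intro i
          simp only [c]
          split_ifs
          · rfl
          · congr 2; ring
        simp_rw [e]
        rw [Finset.prod_ite, Finset.prod_const, Finset.prod_const]
        have h1 : (Finset.univ.filter fun i => i ∈ I) = I := by ext; simp
        have h2 : (Finset.univ.filter fun i => i ∉ I) = Iᶜ := by ext; simp
        rw [h1, h2, Finset.card_compl, hcard, Fintype.card_fin]

lemma uniformSphere_sortAbs_le {n m : ℕ} (hn : 1 ≤ n) (hm : m ≤ n) {s l : ℝ} (hl : 0 ≤ l)
    (hs : 0 ≤ s) (hls : 2 * (l * (1 - s)) < 1) :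
    uniformSphere n {θ | s ≤ ∑ k ∈ Finset.range m, sortAbs θ k ^ 2} ≤ ENNReal.ofReal
      ((n : ℝ) ^ m * ((√(1 - 2 * (l * (1 - s))))⁻¹ ^ m * (√(1 + 2 * (l * s)))⁻¹ ^ (n - m))) := by
  set S := Finset.powersetCard m (Finset.univ : Finset (Fin n))
  have hsub : {θ : EuclideanSpace ℝ (Fin n) | s ≤ ∑ k ∈ Finset.range m, sortAbs θ k ^ 2} ⊆
      ⋃ I ∈ S, {θ | s ≤ ∑ i ∈ I, θ i ^ 2} := by
    intro θ hθ
    obtain ⟨I, hI, h⟩ := sum_range_sortAbs_sq θ hm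
    refine Set.mem_biUnion hI ?_
    change s ≤ _
    rw [← h]
    exact hθ
  calc _ ≤ uniformSphere n (⋃ I ∈ S, {θ | s ≤ ∑ i ∈ I, θ i ^ 2}) := measure_mono hsub
    _ ≤ ∑ I ∈ S, uniformSphere n {θ | s ≤ ∑ i ∈ I, θ i ^ 2} := measure_biUnion_finset_le _ _
    _ ≤ ∑ I ∈ S, ENNReal.ofReal
        ((√(1 - 2 * (l * (1 - s))))⁻¹ ^ m * (√(1 + 2 * (l * s)))⁻¹ ^ (n - m)) := by
        refine Finset.sum_le_sum fun I hI => ?_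
        refine le_trans ?_ (gaussianPi_sum_sq_le hI hl hs hls)
        rw [uniformSphere_eq_map_normalize hn, Measure.map_apply measurable_normalize
          (measurableSet_le (by fun_prop) (by fun_prop))]
        refine measure_mono fun x hx => ?_
        change s ≤ ∑ i ∈ I, normalize x i ^ 2 at hx
        change s * ∑ j, x j ^ 2 ≤ ∑ i ∈ I, x i ^ 2
        have hq : 0 ≤ ∑ j, x j ^ 2 := Finset.sum_nonneg fun _ _ => sq_nonneg _
        simp_rw [normalize_apply, div_pow, Real.sq_sqrt hq] at hx
        rw [← Finset.sum_div] at hx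
        rcases hq.eq_or_lt with h0 | h0
        · rw [← h0, mul_zero]
          exact Finset.sum_nonneg fun _ _ => sq_nonneg _
        · rwa [le_div_iff₀ h0] at hx
    _ ≤ _ := by
        rw [Finset.sum_const, Finset.card_powersetCard, Finset.card_univ, Fintype.card_fin,
          nsmul_eq_mul, ENNReal.ofReal_mul (p := (n : ℝ) ^ m) (by positivity),
          ENNReal.ofReal_pow (p := (n : ℝ)) (by positivity), ENNReal.ofReal_natCast]
        gcongr
        exact_mod_cast Nat.choose_le_pow n m

lemma eventually_uniformSphere_sortAbs_le {b s : ℝ} (hb : 0 < b) (hbs : 1 - Real.exp (-2 * b) < s)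
    (hs1 : s < 1) (m : ℕ) :
    ∀ᶠ n : ℕ in atTop, uniformSphere n {θ | s ≤ ∑ k ∈ Finset.range m, sortAbs θ k ^ 2} ≤
      ENNReal.ofReal (Real.exp (-b * n)) := by
  -- The slack `a - b` absorbs the factor `n ^ m` from the union bound.
  obtain ⟨a, hba, has⟩ : ∃ a, b < a ∧ 1 - Real.exp (-2 * a) < s := by
    have hc : Continuous fun a : ℝ => 1 - Real.exp (-2 * a) := by fun_prop
    have h1 : ∀ᶠ a in 𝓝[>] b, 1 - Real.exp (-2 * a) < s :=
      (hc.continuousAt.eventually_lt_const hbs).filter_mono nhdsWithin_le_nhds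
    obtain ⟨a, ha, ha2⟩ := (h1.and self_mem_nhdsWithin).exists
    exact ⟨a, ha2, ha⟩
  have hs : 0 < s := by
    have : Real.exp (-2 * a) < 1 := Real.exp_lt_one_iff.2 (by linarith)
    linarith
  have hea : 1 < Real.exp (2 * a) := Real.one_lt_exp_iff.2 (by linarith)
  have hprod : Real.exp (2 * a) * Real.exp (-2 * a) = 1 := by
    rw [← Real.exp_add]; simp
  -- Chosen so that `1 + 2 * l * s = exp (2 * a)`: each of the `n - m` other coordinates contributes
  -- `exp (-a)`. Integrability, `2 * l * (1 - s) < 1`, is then exactly `1 - exp (-2 * a) < s`.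
  set l := (Real.exp (2 * a) - 1) / (2 * s)
  have hl : 0 ≤ l := div_nonneg (by linarith) (by linarith)
  have hls : 2 * (l * s) = Real.exp (2 * a) - 1 := by simp only [l]; field_simp
  have hl1 : 2 * (l * (1 - s)) < 1 := by
    have h2 : 2 * (l * (1 - s)) = 2 * (l * s) / s - 2 * (l * s) := by field_simp
    rw [h2, hls, sub_lt_iff_lt_add, div_lt_iff₀ hs]
    nlinarith
  have hB : (√(1 + 2 * (l * s)))⁻¹ = Real.exp (-a) := by
    rw [hls, add_sub_cancel, show 2 * a = a + a by ring, Real.exp_add,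
      Real.sqrt_mul_self (Real.exp_pos _).le, Real.exp_neg]
  set A := (√(1 - 2 * (l * (1 - s))))⁻¹
  have hlim : Tendsto (fun n : ℕ => (A * Real.exp a) ^ m * ((n : ℝ) ^ m /
      Real.exp ((a - b) * n))) atTop (𝓝 0) := by
    have h1 := (isLittleO_pow_exp_pos_mul_atTop m (sub_pos.2 hba)).tendsto_div_nhds_zero
    simpa using (h1.comp tendsto_natCast_atTop_atTop).const_mul ((A * Real.exp a) ^ m)
  filter_upwards [hlim.eventually_le_const zero_lt_one, eventually_ge_atTop m,
    eventually_ge_atTop 1] with n h1 hm hn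
  refine (uniformSphere_sortAbs_le hn hm hl hs.le hl1).trans (ENNReal.ofReal_le_ofReal ?_)
  rw [hB]
  have e1 : Real.exp (-a) ^ (n - m) = Real.exp a ^ m * Real.exp (-(a - b) * n) *
      Real.exp (-b * n) := by
    rw [← Real.exp_nat_mul, ← Real.exp_nat_mul, ← Real.exp_add, ← Real.exp_add, Nat.cast_sub hm]
    congr 1
    ring
  rw [e1]
  have e2 : (n : ℝ) ^ m * (A ^ m * (Real.exp a ^ m * Real.exp (-(a - b) * n) *
      Real.exp (-b * n))) = ((A * Real.exp a) ^ m * ((n : ℝ) ^ m / Real.exp ((a - b) * n))) *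
      Real.exp (-b * n) := by
    rw [mul_pow, div_eq_mul_inv, ← Real.exp_neg, neg_mul]
    ring
  rw [e2]
  exact mul_le_of_le_one_left (Real.exp_pos _).le h1

/-! ## Concentration of Gaussian vectors -/

lemma memLp_sq_gaussianReal : MemLp (fun x : ℝ => x ^ 2) 2 (gaussianReal 0 1) := by
  rw [memLp_two_iff_integrable_sq (by fun_prop)]
  have h := (memLp_id_gaussianReal (μ := 0) (v := 1) 4).integrable_norm_pow (p := 4) (by norm_num)
  refine h.congr (Eventually.of_forall fun x => ?_)
  simp only [id, Real.norm_eq_abs]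
  rw [show (4 : ℕ) = 2 * 2 from rfl, pow_mul, sq_abs]

lemma integral_sq_gaussianReal : ∫ x, x ^ 2 ∂(gaussianReal 0 1) = 1 := by
  have h := variance_of_integral_eq_zero (X := fun x : ℝ => x) (μ := gaussianReal 0 1)
    (by fun_prop) integral_id_gaussianReal
  rw [variance_fun_id_gaussianReal] at h
  simpa using h.symm

lemma memLp_eval {n : ℕ} {f : ℝ → ℝ} {p : ℝ≥0∞} (hf : MemLp f p (gaussianReal 0 1)) (i : Fin n) :
    MemLp (fun x : Fin n → ℝ => f (x i)) p (gaussianPi n) :=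
  hf.comp_measurePreserving (measurePreserving_eval (fun _ : Fin n => gaussianReal 0 1) i)

lemma gaussianPi_chebyshev {n : ℕ} {f : Fin n → ℝ → ℝ} (hf : ∀ i, MemLp (f i) 2 (gaussianReal 0 1))
    {c : ℝ} (hc : 0 < c) :
    gaussianPi n {x | c ≤ |∑ i, f i (x i) - ∑ i, ∫ y, f i y ∂(gaussianReal 0 1)|} ≤
      ENNReal.ofReal ((∑ i, variance (f i) (gaussianReal 0 1)) / c ^ 2) := by
  have hm : MemLp (∑ i, fun x : Fin n → ℝ => f i (x i)) 2 (gaussianPi n) :=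
    memLp_finsetSum' _ fun i _ => memLp_eval (hf i) i
  have h := meas_ge_le_variance_div_sq hm hc
  have hv : variance (∑ i, fun x : Fin n → ℝ => f i (x i)) (gaussianPi n) =
      ∑ i, variance (f i) (gaussianReal 0 1) := by
    unfold gaussianPi
    exact variance_sum_pi hf
  have hint : ∫ x, (∑ i, fun x : Fin n → ℝ => f i (x i)) x ∂(gaussianPi n) =
      ∑ i, ∫ y, f i y ∂(gaussianReal 0 1) := by
    simp only [Finset.sum_apply]
    rw [integral_finsetSum _ fun i _ => (memLp_eval (hf i) i).integrable one_le_two]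
    refine Finset.sum_congr rfl fun i _ => ?_
    unfold gaussianPi
    exact integral_comp_eval (hf i).aestronglyMeasurable
  rw [hv, hint] at h
  simpa only [Finset.sum_apply] using h

/-- The good event: the empirical second moment is near `1`, the weighted sum is small and all
coordinates are small compared to `√n`. -/
def typicalSet (α : ℕ → ℝ) (δ : ℝ) (n : ℕ) : Set (Fin n → ℝ) :=
  {x | |∑ i, x i ^ 2 - n| ≤ δ * n ∧ |∑ i : Fin n, α i * x i| ≤ δ * √n ∧ ∀ i, |x i| ≤ δ * √n}

lemma eventually_half_le_typicalSet {α : ℕ → ℝ} (hα : α ∈ unitSeq) {δ : ℝ} (hδ : 0 < δ) :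
    ∀ᶠ n : ℕ in atTop, 2⁻¹ ≤ gaussianPi n (typicalSet α δ n) := by
  set V := variance (fun x : ℝ => x ^ 2) (gaussianReal 0 1)
  have hV : 0 ≤ V := variance_nonneg _ _
  have key : ∀ n : ℕ, 1 ≤ n → 2 / δ ^ 2 ≤ n → gaussianPi n (typicalSet α δ n)ᶜ ≤
      ENNReal.ofReal ((V / δ ^ 2 + 1 / δ ^ 2 + 4 * V / δ ^ 4) * (n : ℝ)⁻¹) := by
    intro n hn hn2
    have hn0 : (0 : ℝ) < n := by exact_mod_cast hn
    have hsn : 0 < √(n : ℝ) := Real.sqrt_pos.2 hn0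
    have h1 : gaussianPi n {x | δ * n ≤ |∑ i, x i ^ 2 - n|} ≤
        ENNReal.ofReal (V / δ ^ 2 * (n : ℝ)⁻¹) := by
      have h := gaussianPi_chebyshev (n := n) (fun _ => memLp_sq_gaussianReal)
        (c := δ * n) (by positivity)
      simp only [integral_sq_gaussianReal, Finset.sum_const, Finset.card_univ, Fintype.card_fin,
        nsmul_eq_mul, mul_one] at h
      refine h.trans (ENNReal.ofReal_le_ofReal (le_of_eq ?_))
      field_simp
      rfl
    have h2 : gaussianPi n {x | δ * √n ≤ |∑ i : Fin n, α i * x i|} ≤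
        ENNReal.ofReal (1 / δ ^ 2 * (n : ℝ)⁻¹) := by
      have hm : ∀ i : Fin n, MemLp (fun x : ℝ => α i * x) 2 (gaussianReal 0 1) := fun i =>
        (memLp_id_gaussianReal (μ := 0) (v := 1) 2).const_mul (α i)
      have h := gaussianPi_chebyshev (n := n) hm (c := δ * √n) (by positivity)
      have e1 : ∀ i : Fin n, ∫ y, α i * y ∂(gaussianReal 0 1) = 0 := by
        intro i
        rw [integral_const_mul, integral_id_gaussianReal, mul_zero]
      have e2 : ∀ i : Fin n, variance (fun x : ℝ => α i * x) (gaussianReal 0 1) = α i ^ 2 := by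
        intro i
        rw [variance_const_mul, variance_fun_id_gaussianReal]
        simp
      simp only [e1, e2, Finset.sum_const_zero, sub_zero] at h
      refine h.trans (ENNReal.ofReal_le_ofReal ?_)
      have h3 := hα.2.2 n
      rw [Finset.sum_range] at h3
      rw [mul_pow, Real.sq_sqrt hn0.le, ← div_eq_mul_inv, div_div]
      gcongr
    -- Chebyshev for `x ^ 2` gives order `n⁻²` per coordinate, so a union over `n` coordinates still
    -- tends to `0`. The lower bound on `n` gives `δ ^ 2 * n - 1 ≥ δ ^ 2 * n / 2`.
    have h3 : ∀ i : Fin n, gaussianPi n {x | δ * √n ≤ |x i|} ≤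
        ENNReal.ofReal (4 * V / δ ^ 4 * (n : ℝ)⁻¹ * (n : ℝ)⁻¹) := by
      intro i
      have hd : 0 < δ ^ 2 * n / 2 := by positivity
      have h := meas_ge_le_variance_div_sq memLp_sq_gaussianReal hd
      rw [integral_sq_gaussianReal] at h
      have hp := measurePreserving_eval (fun _ : Fin n => gaussianReal 0 1) i
      have e : gaussianPi n {x | δ * √n ≤ |x i|} = gaussianReal 0 1 {x | δ * √n ≤ |x|} := by
        rw [← hp.measure_preimage (measurableSet_le (by fun_prop) (by fun_prop)).nullMeasurableSet]
        rfl
      rw [e]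
      refine (measure_mono fun x hx => ?_).trans (h.trans (ENNReal.ofReal_le_ofReal (le_of_eq ?_)))
      · change δ * √n ≤ |x| at hx
        change δ ^ 2 * n / 2 ≤ |x ^ 2 - 1|
        have hx2 : (δ * √n) ^ 2 ≤ |x| ^ 2 := pow_le_pow_left₀ (by positivity) hx 2
        rw [mul_pow, Real.sq_sqrt hn0.le, sq_abs] at hx2
        have h4 : 2 ≤ n * δ ^ 2 := (div_le_iff₀ (by positivity)).1 hn2
        refine le_trans ?_ (le_abs_self _)
        linarith
      · change V / _ = _
        field_simp
        ring
    have hsub : (typicalSet α δ n)ᶜ ⊆ ({x | δ * n ≤ |∑ i, x i ^ 2 - n|} ∪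
        {x | δ * √n ≤ |∑ i : Fin n, α i * x i|}) ∪
        ⋃ i ∈ (Finset.univ : Finset (Fin n)), {x | δ * √n ≤ |x i|} := by
      intro x hx
      by_contra hcon
      simp only [Set.mem_union, Set.mem_ofPred_eq, Set.mem_iUnion, Finset.mem_univ, exists_prop,
        true_and, not_or, not_exists, not_le] at hcon
      exact hx ⟨hcon.1.1.le, hcon.1.2.le, fun i => (hcon.2 i).le⟩
    calc _ ≤ _ := measure_mono hsub
      _ ≤ _ := measure_union_le _ _
      _ ≤ (_ + _) + _ := add_le_add (measure_union_le _ _) (measure_biUnion_finset_le _ _)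
      _ ≤ (ENNReal.ofReal (V / δ ^ 2 * (n : ℝ)⁻¹) + ENNReal.ofReal (1 / δ ^ 2 * (n : ℝ)⁻¹)) +
          ∑ _i : Fin n, ENNReal.ofReal (4 * V / δ ^ 4 * (n : ℝ)⁻¹ * (n : ℝ)⁻¹) :=
          add_le_add (add_le_add h1 h2) (Finset.sum_le_sum fun i _ => h3 i)
      _ = _ := by
          rw [Finset.sum_const, Finset.card_univ, Fintype.card_fin, nsmul_eq_mul,
            ← ENNReal.ofReal_natCast, ← ENNReal.ofReal_mul (by positivity),
            ← ENNReal.ofReal_add (by positivity) (by positivity),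
            ← ENNReal.ofReal_add (by positivity) (by positivity)]
          congr 1
          field_simp
  have hlim : Tendsto (fun n : ℕ => (V / δ ^ 2 + 1 / δ ^ 2 + 4 * V / δ ^ 4) * (n : ℝ)⁻¹) atTop
      (𝓝 0) := by
    have h := (tendsto_inv_atTop_nhds_zero_nat (𝕜 := ℝ)).const_mul
      (V / δ ^ 2 + 1 / δ ^ 2 + 4 * V / δ ^ 4)
    rwa [mul_zero] at h
  filter_upwards [hlim.eventually_le_const (show (0 : ℝ) < 2⁻¹ by norm_num),
    eventually_ge_atTop 1, tendsto_natCast_atTop_atTop.eventually_ge_atTop (2 / δ ^ 2)]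
    with n h1 hn hn2
  have h2 := (key n hn hn2).trans (ENNReal.ofReal_le_ofReal h1)
  have hms : MeasurableSet (typicalSet α δ n) := by
    have e : typicalSet α δ n = {x : Fin n → ℝ | |∑ i, x i ^ 2 - n| ≤ δ * n} ∩
        ({x | |∑ i : Fin n, α i * x i| ≤ δ * √n} ∩ ⋂ i, {x | |x i| ≤ δ * √n}) := by
      ext x; simp [typicalSet]
    rw [e]
    exact (measurableSet_le (by fun_prop) (by fun_prop)).inter
      ((measurableSet_le (by fun_prop) (by fun_prop)).inter
        (MeasurableSet.iInter fun i => measurableSet_le (by fun_prop) (by fun_prop)))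
  have h3 := prob_add_prob_compl (μ := gaussianPi n) hms
  have e4 : ENNReal.ofReal (2⁻¹ : ℝ) = 2⁻¹ := by
    rw [ENNReal.ofReal_inv_of_pos two_pos]; simp
  rw [e4] at h2
  by_contra hcon
  push Not at hcon
  have h5 : gaussianPi n (typicalSet α δ n) + gaussianPi n (typicalSet α δ n)ᶜ < 2⁻¹ + 2⁻¹ :=
    ENNReal.add_lt_add_of_lt_of_le (ne_top_of_le_ne_top (by simp) h2) hcon h2
  rw [h3, ENNReal.inv_two_add_inv_two] at h5
  exact lt_irrefl _ h5

/-! ## Lower bound for a point on the sphere to be near a given sequence -/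

/-- The limiting variance of the Gaussian component, as a nonnegative real. -/
def residualVar (α : ℕ → ℝ) : ℝ≥0 := (1 - ∑' k, α k ^ 2).toNNReal

/-- The rate of a sequence of norm less than one. -/
def seqRate (α : ℕ → ℝ) : ℝ := -(1 / 2) * Real.log (1 - ∑' k, α k ^ 2)

lemma coe_residualVar {α : ℕ → ℝ} (hα : α ∈ unitSeq) :
    (residualVar α : ℝ) = 1 - ∑' k, α k ^ 2 :=
  Real.coe_toNNReal _ (by linarith [unitSeq_tsum_le hα])

/-- The set of vectors near `√n α` whose norm and whose distance to `√n α` are typical. -/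
def tiltedSet (α : ℕ → ℝ) (δ : ℝ) (n : ℕ) : Set (Fin n → ℝ) :=
  {x | |∑ i, x i ^ 2 - n| ≤ δ * n ∧
    |∑ i : Fin n, (x i - √n * α i) ^ 2 - residualVar α * n| ≤ δ * n ∧
    ∀ i : Fin n, |x i - √n * α i| ≤ δ * √n}

lemma measurableSet_tiltedSet (α : ℕ → ℝ) (δ : ℝ) (n : ℕ) : MeasurableSet (tiltedSet α δ n) := by
  have e : tiltedSet α δ n = {x : Fin n → ℝ | |∑ i, x i ^ 2 - n| ≤ δ * n} ∩
      ({x | |∑ i : Fin n, (x i - √n * α i) ^ 2 - residualVar α * n| ≤ δ * n} ∩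
        ⋂ i : Fin n, {x | |x i - √n * α i| ≤ δ * √n}) := by
    ext x; simp [tiltedSet]
  rw [e]
  exact (measurableSet_le (by fun_prop) (by fun_prop)).inter
    ((measurableSet_le (by fun_prop) (by fun_prop)).inter
      (MeasurableSet.iInter fun i => measurableSet_le (by fun_prop) (by fun_prop)))

/-- The affine map that turns standard Gaussian vectors into tilted ones. -/
def tilt (α : ℕ → ℝ) (n : ℕ) (g : Fin n → ℝ) : Fin n → ℝ :=
  fun i => √(residualVar α) * g i + √n * α i

lemma map_tilt (α : ℕ → ℝ) (n : ℕ) : (gaussianPi n).map (tilt α n) =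
    Measure.pi fun i : Fin n => gaussianReal (√n * α i) (residualVar α) := by
  have h1 : ∀ i : Fin n, (gaussianReal 0 1).map (fun x => √(residualVar α) * x + √n * α i) =
      gaussianReal (√n * α i) (residualVar α) := by
    intro i
    have e : (fun x => √(residualVar α) * x + √n * α i) =
        (fun x => x + √n * α i) ∘ fun x => √(residualVar α) * x := rfl
    rw [e, ← Measure.map_map (by fun_prop) (by fun_prop), gaussianReal_map_const_mul,
      gaussianReal_map_add_const, mul_zero, zero_add, mul_one]
    congr 1
    ext
    simp
  have hs : ∀ i : Fin n, SigmaFinite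
      ((gaussianReal 0 1).map (fun x => √(residualVar α) * x + √n * α i)) := fun i => by
    rw [h1]; infer_instance
  have h := Measure.pi_map_pi (μ := fun _ : Fin n => gaussianReal 0 1)
    (f := fun i x => √(residualVar α) * x + √n * α i) (by fun_prop)
  simp_rw [h1] at h
  exact h

/-- Expanding the square, the tilted vector has squared norm near `v * n + n * ‖α‖² = n`. The error
budget is `δ / 4` for the quadratic term, `δ / 2` for the cross term and `δ / 4` for cutting `‖α‖²`
at `n` terms. -/
lemma eventually_mapsTo_tilt {α : ℕ → ℝ} (hα : α ∈ unitSeq) {δ : ℝ} (hδ : 0 < δ) :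
    ∀ᶠ n : ℕ in atTop, Set.MapsTo (tilt α n) (typicalSet α (δ / 4) n) (tiltedSet α δ n) := by
  have hv := coe_residualVar hα
  have hv0 : (0 : ℝ) ≤ residualVar α := (residualVar α).2
  have hv1 : (residualVar α : ℝ) ≤ 1 := by
    rw [hv]; linarith [tsum_nonneg (L := SummationFilter.unconditional ℕ)
      (fun k => sq_nonneg (α k))]
  set v : ℝ := (residualVar α : ℝ)
  have hs1 : √v ≤ 1 := Real.sqrt_le_one.2 hv1
  have hs0 : 0 ≤ √v := Real.sqrt_nonneg _
  have hlim := (unitSeq_summable hα).hasSum.tendsto_sum_nat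
  filter_upwards [hlim.eventually_const_le (show ∑' k, α k ^ 2 - δ / 4 < ∑' k, α k ^ 2 by linarith),
    eventually_ge_atTop 1] with n htail hn g hg
  obtain ⟨h1, h2, h3⟩ := hg
  have hn0 : (0 : ℝ) < n := by exact_mod_cast hn
  have hsn : √(n : ℝ) * √n = n := Real.mul_self_sqrt hn0.le
  have hsn0 : 0 < √(n : ℝ) := Real.sqrt_pos.2 hn0
  have hvv : √v * √v = v := Real.mul_self_sqrt hv0
  have hS := (unitSeq_summable hα).sum_le_tsum (Finset.range n) fun _ _ => sq_nonneg _
  rw [Finset.sum_range] at htail hS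
  have hd : ∀ i, tilt α n g i - √n * α i = √v * g i := fun i => by simp only [tilt, v]; ring
  have e1 : ∑ i, tilt α n g i ^ 2 = v * ∑ i, g i ^ 2 + 2 * √v * √n * ∑ i : Fin n, α i * g i +
      n * ∑ i : Fin n, α i ^ 2 := by
    rw [Finset.mul_sum, Finset.mul_sum, Finset.mul_sum, ← Finset.sum_add_distrib,
      ← Finset.sum_add_distrib]
    refine Finset.sum_congr rfl fun i _ => ?_
    change (√v * g i + √n * α i) ^ 2 = _
    linear_combination g i ^ 2 * hvv + α i ^ 2 * hsn
  have e2 : ∑ i, (tilt α n g i - √n * α i) ^ 2 = v * ∑ i, g i ^ 2 := by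
    rw [Finset.mul_sum]
    refine Finset.sum_congr rfl fun i _ => ?_
    rw [hd]
    linear_combination g i ^ 2 * hvv
  have hA : |v * (∑ i, g i ^ 2 - n)| ≤ δ / 4 * n := by
    rw [abs_mul, abs_of_nonneg hv0]
    exact (mul_le_of_le_one_left (abs_nonneg _) hv1).trans h1
  refine ⟨?_, ?_, fun i => ?_⟩
  · have hB : |2 * √v * √n * ∑ i : Fin n, α i * g i| ≤ δ / 2 * n := by
      rw [abs_mul, abs_of_nonneg (by positivity)]
      calc 2 * √v * √n * |∑ i : Fin n, α i * g i| ≤ 2 * 1 * √n * (δ / 4 * √n) := by gcongr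
        _ = δ / 2 * (√n * √n) := by ring
        _ = _ := by rw [hsn]
    have hC : |n * (∑ i : Fin n, α i ^ 2 - ∑' k, α k ^ 2)| ≤ δ / 4 * n := by
      rw [abs_mul, abs_of_pos hn0, mul_comm]
      refine mul_le_mul_of_nonneg_right ?_ hn0.le
      rw [abs_le]
      constructor <;> linarith
    rw [e1]
    have e3 : v * ∑ i, g i ^ 2 + 2 * √v * √n * ∑ i : Fin n, α i * g i +
        n * ∑ i : Fin n, α i ^ 2 - n = v * (∑ i, g i ^ 2 - n) +
        2 * √v * √n * ∑ i : Fin n, α i * g i + n * (∑ i : Fin n, α i ^ 2 - ∑' k, α k ^ 2) := by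
      linear_combination n * hv
    rw [e3]
    rw [abs_le] at hA hB hC ⊢
    constructor <;> linarith [hA.1, hA.2, hB.1, hB.2, hC.1, hC.2]
  · rw [e2, ← mul_sub]
    exact hA.trans (by nlinarith)
  · rw [hd, abs_mul, abs_of_nonneg hs0]
    refine (mul_le_of_le_one_left (abs_nonneg _) hs1).trans ((h3 i).trans ?_)
    nlinarith

lemma abs_normalize_sub_le {α : ℕ → ℝ} (hα : α ∈ unitSeq) {δ : ℝ} (hδ : δ ≤ 1 / 2)
    {n : ℕ} (hn : 1 ≤ n) {x : Fin n → ℝ} (hx : x ∈ tiltedSet α δ n) (i : Fin n) :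
    |normalize x i - α i| ≤ 4 * δ := by
  obtain ⟨h1, -, h3⟩ := hx
  have hn0 : (0 : ℝ) < n := by exact_mod_cast hn
  have hsn0 : 0 < √(n : ℝ) := Real.sqrt_pos.2 hn0
  set q := ∑ j, x j ^ 2
  have hq : (1 - δ) * n ≤ q := by linarith [(abs_le.1 h1).1]
  have hq2 : q ≤ (1 + δ) * n := by linarith [(abs_le.1 h1).2]
  have hδ0 : 0 ≤ δ := by
    have := (abs_nonneg _).trans h1
    exact nonneg_of_mul_nonneg_left this hn0
  have hq0 : 0 < q := lt_of_lt_of_le (by nlinarith) hq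
  -- `r` corrects the scaling by `√n` to the actual norm. Since `r ≤ 2` and `|r - 1| ≤ 2 * δ`, the
  -- two error terms are at most `2 * δ` each.
  set r := √(n / q)
  have hr0 : 0 ≤ r := Real.sqrt_nonneg _
  have hrr : r ^ 2 = n / q := Real.sq_sqrt (by positivity)
  have hrq : r ^ 2 * q = n := by rw [hrr]; field_simp
  have hr2 : r ^ 2 ≤ 1 + 2 * δ := by
    rw [hrr, div_le_iff₀ hq0]
    nlinarith [mul_nonneg hδ0 hn0.le]
  have hr3 : 1 - 2 * δ ≤ r ^ 2 := by
    rw [hrr, le_div_iff₀ hq0]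
    nlinarith [mul_nonneg hδ0 hn0.le]
  have hr4 : r ≤ 2 := by nlinarith
  have hr5 : |r - 1| ≤ 2 * δ := by
    rw [abs_le]
    constructor
    · rcases le_total r 1 with h | h <;> nlinarith
    · rcases le_total r 1 with h | h <;> nlinarith
  have hα1 : |α i| ≤ 1 := by
    rw [abs_of_nonneg (hα.2.1 _)]
    have h := unitSeq_sq_le hα i
    have h2 : 1 / (((i : ℕ) : ℝ) + 1) ≤ 1 := by
      rw [div_le_one (by positivity)]; linarith [(Nat.cast_nonneg (i : ℕ) : (0 : ℝ) ≤ (i : ℕ))]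
    nlinarith [hα.2.1 i]
  have e : normalize x i - α i = r * ((x i - √n * α i) / √n) + (r - 1) * α i := by
    rw [normalize_apply]
    simp only [r]
    rw [Real.sqrt_div hn0.le]
    have := (Real.sqrt_pos.2 hq0).ne'
    change x i / √q - α i = _
    field_simp
    ring
  rw [e]
  have h4 : |(x i - √n * α i) / √n| ≤ δ := by
    rw [abs_div, abs_of_pos hsn0, div_le_iff₀ hsn0]
    exact h3 i
  calc _ ≤ |r * ((x i - √n * α i) / √n)| + |(r - 1) * α i| := abs_add_le _ _
    _ = r * |(x i - √n * α i) / √n| + |r - 1| * |α i| := by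
        rw [abs_mul, abs_mul, abs_of_nonneg hr0]
    _ ≤ 2 * δ + 2 * δ * 1 := by gcongr
    _ = _ := by ring

/-- Change of measure: on `tiltedSet` the two Gaussian exponents are both `-n / 2` up to errors `δ *
n / 2` and `δ * n / (2 * v)`. The ratio of normalizing constants, `v ^ (n / 2)`, is `exp (-seqRate α
* n)`. -/
lemma gaussianPi_tiltedSet_ge {α : ℕ → ℝ} (hα : Admissible α) (δ : ℝ) (n : ℕ) :
    ENNReal.ofReal (Real.exp (-(seqRate α + δ * (1 + (residualVar α : ℝ)⁻¹) / 2) * n)) *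
      (gaussianPi n).map (tilt α n) (tiltedSet α δ n) ≤ gaussianPi n (tiltedSet α δ n) := by
  have hv := coe_residualVar hα.mem_unitSeq
  have hvpos : (0 : ℝ) < residualVar α := by rw [hv]; linarith [hα.tsum_lt_one]
  have hvne : residualVar α ≠ 0 := by
    intro h; rw [h] at hvpos; exact lt_irrefl _ hvpos
  have hms := measurableSet_tiltedSet α δ n
  rw [map_tilt, pi_gaussianReal_eq_withDensity _ hvne, gaussianPi,
    pi_gaussianReal_eq_withDensity _ one_ne_zero, withDensity_apply _ hms, withDensity_apply _ hms,
    ← lintegral_const_mul _ (f := fun x : Fin n → ℝ =>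
        ∏ i : Fin n, gaussianPDF (√n * α i) (residualVar α) (x i))
      (Finset.measurable_prod _ fun i _ =>
        (measurable_gaussianPDF _ _).comp (measurable_pi_apply i))]
  refine setLIntegral_mono' hms fun x hx => ?_
  rw [prod_gaussianPDF (fun i : Fin n => √n * α i), prod_gaussianPDF (fun _ : Fin n => 0),
    ← ENNReal.ofReal_mul (Real.exp_pos _).le]
  refine ENNReal.ofReal_le_ofReal ?_
  obtain ⟨h1, h2, -⟩ := hx
  set v : ℝ := (residualVar α : ℝ)
  have hrate : Real.exp (-(seqRate α) * n) = √v ^ n := by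
    unfold seqRate
    rw [← hv, Real.sqrt_eq_rpow, Real.rpow_def_of_pos hvpos, ← Real.exp_nat_mul]
    congr 1
    ring
  have hsplit : Real.exp (-(seqRate α + δ * (1 + v⁻¹) / 2) * n) =
      √v ^ n * Real.exp (-(δ * (1 + v⁻¹) / 2) * n) := by
    rw [← hrate, ← Real.exp_add]
    congr 1
    ring
  have hsv : √v ≠ 0 := (Real.sqrt_pos.2 hvpos).ne'
  rw [hsplit, Real.sqrt_mul (by positivity) v, mul_inv, mul_pow]
  simp only [NNReal.coe_one, mul_one, sub_zero]
  have e : √v ^ n * Real.exp (-(δ * (1 + v⁻¹) / 2) * n) * ((√(2 * Real.pi))⁻¹ ^ n * (√v)⁻¹ ^ n *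
      Real.exp (-(∑ i : Fin n, (x i - √n * α i) ^ 2) / (2 * v))) =
      (√v ^ n * (√v)⁻¹ ^ n) * ((√(2 * Real.pi))⁻¹ ^ n * Real.exp (-(δ * (1 + v⁻¹) / 2) * n +
      -(∑ i : Fin n, (x i - √n * α i) ^ 2) / (2 * v))) := by
    rw [Real.exp_add]; ring
  rw [e, ← mul_pow, mul_inv_cancel₀ hsv, one_pow, one_mul]
  refine mul_le_mul_of_nonneg_left (Real.exp_le_exp.2 ?_) (by positivity)
  have h3 := (abs_le.1 h1).2
  have h4 := (abs_le.1 h2).1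
  have h5 : (v * n - δ * n) / (2 * v) ≤ (∑ i : Fin n, (x i - √n * α i) ^ 2) / (2 * v) := by
    gcongr
    linarith
  have h6 : (v * n - δ * n) / (2 * v) = n / 2 - δ * n * v⁻¹ / 2 := by
    field_simp
  rw [h6] at h5
  rw [neg_div]
  linarith

lemma eventually_le_uniformSphere {α : ℕ → ℝ} (hα : Admissible α) {η ε : ℝ} (hη : 0 < η)
    (hε : 0 < ε) :
    ∀ᶠ n : ℕ in atTop, ENNReal.ofReal (Real.exp (-(seqRate α + ε) * n)) ≤
      uniformSphere n {θ | ∀ i : Fin n, |θ i - α i| ≤ η} := by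
  have hα' := hα.mem_unitSeq
  have hv := coe_residualVar hα'
  have hvpos : (0 : ℝ) < residualVar α := by rw [hv]; linarith [hα.tsum_lt_one]
  set c : ℝ := (1 + (residualVar α : ℝ)⁻¹) / 2
  have hc : 0 < c := by positivity
  -- The three bounds serve normalization, the distance `4 * δ ≤ η`, and the density loss `δ * c ≤ ε
  -- / 2`; the other `ε / 2` absorbs the probability `1 / 2`.
  set δ : ℝ := min (1 / 2) (min (η / 4) (ε / 2 / c))
  have hδ : 0 < δ := by positivity
  have hδ1 : δ ≤ 1 / 2 := min_le_left _ _
  have hδ2 : δ ≤ η / 4 := (min_le_right _ _).trans (min_le_left _ _)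
  have hδ3 : δ * c ≤ ε / 2 :=
    (le_div_iff₀ hc).1 ((min_le_right _ _).trans (min_le_right _ _))
  have hlim : Tendsto (fun n : ℕ => Real.exp (-(ε / 2 * n))) atTop (𝓝 0) := by
    refine Real.tendsto_exp_neg_atTop_nhds_zero.comp ?_
    exact Tendsto.const_mul_atTop (by positivity) tendsto_natCast_atTop_atTop
  filter_upwards [eventually_half_le_typicalSet hα' (show 0 < δ / 4 by positivity),
    eventually_mapsTo_tilt hα' hδ, eventually_ge_atTop 1,
    hlim.eventually_le_const (show (0 : ℝ) < 2⁻¹ by norm_num)] with n h1 h2 hn h3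
  have hmeas : MeasurableSet {θ : EuclideanSpace ℝ (Fin n) | ∀ i : Fin n, |θ i - α i| ≤ η} := by
    have e : {θ : EuclideanSpace ℝ (Fin n) | ∀ i : Fin n, |θ i - α i| ≤ η} =
        ⋂ i, {θ : EuclideanSpace ℝ (Fin n) | |θ i - α i| ≤ η} := by ext; simp
    rw [e]
    exact MeasurableSet.iInter fun i => measurableSet_le (by fun_prop) (by fun_prop)
  have htilt : Measurable (tilt α n) := by unfold tilt; fun_prop
  have h4 : 2⁻¹ ≤ (gaussianPi n).map (tilt α n) (tiltedSet α δ n) := by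
    rw [Measure.map_apply htilt (measurableSet_tiltedSet α δ n)]
    exact h1.trans (measure_mono h2)
  have e2 : ENNReal.ofReal (2⁻¹ : ℝ) = 2⁻¹ := by
    rw [ENNReal.ofReal_inv_of_pos two_pos]; simp
  calc ENNReal.ofReal (Real.exp (-(seqRate α + ε) * n))
      ≤ ENNReal.ofReal (Real.exp (-(seqRate α + δ * (1 + (residualVar α : ℝ)⁻¹) / 2) * n) *
        2⁻¹) := by
        refine ENNReal.ofReal_le_ofReal ?_
        have e3 : Real.exp (-(seqRate α + ε) * n) = Real.exp (-(seqRate α + ε / 2) * n) *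
            Real.exp (-(ε / 2 * n)) := by
          rw [← Real.exp_add]; congr 1; ring
        rw [e3]
        refine mul_le_mul (Real.exp_le_exp.2 ?_) h3 (Real.exp_pos _).le (Real.exp_pos _).le
        have e4 : δ * (1 + (residualVar α : ℝ)⁻¹) / 2 = δ * c := by simp only [c]; ring
        rw [e4]
        refine mul_le_mul_of_nonneg_right ?_ (Nat.cast_nonneg n)
        linarith
    _ = ENNReal.ofReal (Real.exp (-(seqRate α + δ * (1 + (residualVar α : ℝ)⁻¹) / 2) * n)) *
        2⁻¹ := by rw [ENNReal.ofReal_mul (Real.exp_pos _).le, e2]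
    _ ≤ _ * (gaussianPi n).map (tilt α n) (tiltedSet α δ n) := by gcongr
    _ ≤ gaussianPi n (tiltedSet α δ n) := gaussianPi_tiltedSet_ge hα δ n
    _ ≤ _ := by
        rw [uniformSphere_eq_map_normalize hn, Measure.map_apply measurable_normalize hmeas]
        refine measure_mono fun x hx i => ?_
        exact (abs_normalize_sub_le hα' hδ1 hn hx i).trans (by linarith)

/-! ## The rate function -/

/-- The rate function: the contraction of `seqRate` along `α ↦ limitLaw α`. -/
def cubeRate (ν : ProbabilityMeasure ℝ) : ℝ≥0∞ :=
  ⨅ (α : ℕ → ℝ) (_ : Admissible α ∧ ν = limitLaw α), ENNReal.ofReal (seqRate α)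

lemma seqRate_nonneg {α : ℕ → ℝ} (hα : Admissible α) : 0 ≤ seqRate α := by
  have h0 : 0 ≤ ∑' k, α k ^ 2 := tsum_nonneg fun k => sq_nonneg (α k)
  have := Real.log_nonpos (by linarith [hα.tsum_lt_one]) (show 1 - ∑' k, α k ^ 2 ≤ 1 by linarith)
  unfold seqRate
  linarith

lemma seqRate_le_iff {α : ℕ → ℝ} (hα : Admissible α) (a : ℝ) :
    seqRate α ≤ a ↔ ∑' k, α k ^ 2 ≤ 1 - Real.exp (-2 * a) := by
  have h1 : 0 < 1 - ∑' k, α k ^ 2 := by linarith [hα.tsum_lt_one]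
  have h2 : Real.exp (-2 * a) ≤ 1 - ∑' k, α k ^ 2 ↔ -2 * a ≤ Real.log (1 - ∑' k, α k ^ 2) :=
    (Real.le_log_iff_exp_le h1).symm
  unfold seqRate
  constructor
  · intro h
    have := h2.2 (by linarith)
    linarith
  · intro h
    have := h2.1 (by linarith)
    linarith

/-- Identifiability leaves a single sequence in the infimum. -/
lemma cubeRate_limitLaw {α : ℕ → ℝ} (hα : Admissible α) :
    cubeRate (limitLaw α) = ENNReal.ofReal (seqRate α) := by
  refine le_antisymm (iInf₂_le α ⟨hα, rfl⟩) (le_iInf₂ fun β hβ => ?_)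
  rw [injOn_limitLaw hα.mem_unitSeq hβ.1.mem_unitSeq hβ.2]

lemma cubeRate_eq_top {ν : ProbabilityMeasure ℝ}
    (hν : ¬ ∃ α : ℕ → ℝ, Admissible α ∧ ν = limitLaw α) : cubeRate ν = ⊤ :=
  iInf₂_eq_top.2 fun α hα => (hν ⟨α, hα⟩).elim

lemma setOf_cubeRate_le (a : ℝ≥0) : {ν | cubeRate ν ≤ a} =
    limitLaw '' (unitSeq ∩ ⋂ m, {α | ∑ k ∈ Finset.range m, α k ^ 2 ≤ 1 - Real.exp (-2 * a)}) := by
  ext ν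
  constructor
  · intro hν
    change cubeRate ν ≤ a at hν
    by_cases h : ∃ α : ℕ → ℝ, Admissible α ∧ ν = limitLaw α
    · obtain ⟨α, hα, rfl⟩ := h
      rw [cubeRate_limitLaw hα, ENNReal.ofReal_le_iff_le_toReal ENNReal.coe_ne_top,
        ENNReal.coe_toReal, seqRate_le_iff hα] at hν
      refine ⟨α, ⟨hα.mem_unitSeq, Set.mem_iInter.2 fun m => ?_⟩, rfl⟩
      exact (hα.summable.sum_le_tsum _ fun _ _ => sq_nonneg _).trans hν
    · rw [cubeRate_eq_top h] at hν
      exact absurd hν (not_le.2 ENNReal.coe_lt_top)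
  · rintro ⟨α, ⟨hα, hα2⟩, rfl⟩
    have h1 : ∑' k, α k ^ 2 ≤ 1 - Real.exp (-2 * a) :=
      Real.tsum_le_of_sum_range_le (fun _ => sq_nonneg _) fun m => Set.mem_iInter.1 hα2 m
    -- The bound stays strictly below `1`, so limits cannot reach norm `1`, where `Real.log 0 = 0`
    -- would make `seqRate` zero.
    have h2 : Admissible α :=
      admissible_of_mem_unitSeq hα (by linarith [Real.exp_pos (-2 * (a : ℝ))])
    change cubeRate (limitLaw α) ≤ a
    rwa [cubeRate_limitLaw h2, ENNReal.ofReal_le_iff_le_toReal ENNReal.coe_ne_top,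
        ENNReal.coe_toReal, seqRate_le_iff h2]

lemma isGoodRateFunction_cubeRate : IsGoodRateFunction cubeRate := by
  intro a
  rw [setOf_cubeRate_le]
  refine IsCompact.image_of_continuousOn ?_ (continuousOn_limitLaw.mono Set.inter_subset_left)
  exact isCompact_unitSeq.inter_right (isClosed_iInter fun m => isClosed_le (by fun_prop)
    (by fun_prop))

lemma lowerSemicontinuous_cubeRate : LowerSemicontinuous cubeRate := by
  rw [lowerSemicontinuous_iff_isClosed_preimage]
  intro y
  induction y using ENNReal.recTopCoe with
  | top => simp
  | coe a => exact (isGoodRateFunction_cubeRate a).isClosed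

/-! ## The large deviation bounds -/

/-- Product neighbourhoods constrain finitely many coordinates, so weak closeness follows from
closeness of the largest entries. -/
lemma exists_forall_abs_sub_lt {α : ℕ → ℝ} (hα : α ∈ unitSeq) {U : Set (ProbabilityMeasure ℝ)}
    (hU : IsOpen U) (hαU : limitLaw α ∈ U) :
    ∃ δ > 0, ∃ m : ℕ, ∀ β ∈ unitSeq, (∀ k < m, |β k - α k| < δ) → limitLaw β ∈ U := by
  obtain ⟨V, hV, hVU⟩ := (continuousOn_iff'.1 continuousOn_limitLaw) U hU
  have hαV : α ∈ V := by
    have : α ∈ limitLaw ⁻¹' U ∩ unitSeq := ⟨hαU, hα⟩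
    rw [hVU] at this
    exact this.1
  obtain ⟨I, u, hu, hIu⟩ := isOpen_pi_iff.1 hV α hαV
  have hδ : ∀ᶠ δ in 𝓝[>] (0 : ℝ), ∀ k ∈ I, Metric.ball (α k) δ ⊆ u k := by
    rw [Filter.eventually_all_finset]
    intro k hk
    obtain ⟨e, he, hball⟩ := Metric.isOpen_iff.1 (hu k hk).1 _ (hu k hk).2
    filter_upwards [Ioo_mem_nhdsGT he] with δ hδ
    exact (Metric.ball_subset_ball hδ.2.le).trans hball
  obtain ⟨δ, hδ, hδ0⟩ := (hδ.and self_mem_nhdsWithin).exists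
  refine ⟨δ, hδ0, I.sup id + 1, fun β hβ h => ?_⟩
  have hβV : β ∈ V := hIu fun k hk => hδ k hk (by
    rw [Metric.mem_ball, Real.dist_eq]
    exact h k (Nat.lt_succ_of_le (Finset.le_sup (f := id) hk)))
  have : β ∈ V ∩ unitSeq := ⟨hβV, hβ⟩
  rw [← hVU] at this
  exact this.1

lemma eventually_le_uniformSphere_preimage {α : ℕ → ℝ} (hα : Admissible α)
    {U : Set (ProbabilityMeasure ℝ)} (hU : IsOpen U) (hαU : limitLaw α ∈ U) {ε : ℝ} (hε : 0 < ε) :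
    ∀ᶠ n : ℕ in atTop, ENNReal.ofReal (Real.exp (-(seqRate α + ε) * n)) ≤
      uniformSphere n (discreteProjection ⁻¹' U) := by
  obtain ⟨δ, hδ, m, h⟩ := exists_forall_abs_sub_lt hα.mem_unitSeq hU hαU
  filter_upwards [eventually_le_uniformSphere hα (half_pos hδ) hε, eventually_ge_atTop m]
    with n h1 hm
  refine h1.trans (measure_mono_ae ?_)
  filter_upwards [ae_norm_eq_one_uniformSphere] with θ hθ hθ2
  change discreteProjection θ ∈ U
  rw [← limitLaw_sortAbs hθ]
  refine h _ (sortAbs_mem_unitSeq hθ) fun k hk => ?_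
  exact (abs_sortAbs_sub_le hα.antitone hα.nonneg hθ2 (hk.trans_le hm)).trans_lt (half_lt_self hδ)

/-- Partial sums of squares increase to a limit above `s` at every point of the compact preimage of
`C`, so by compactness one `m` works for all of them. -/
lemma eventually_uniformSphere_preimage_le {C : Set (ProbabilityMeasure ℝ)} (hC : IsClosed C)
    {b b' : ℝ} (hb : 0 < b) (hbb' : b < b')
    (hI : ∀ α, Admissible α → limitLaw α ∈ C → b' < seqRate α) :
    ∀ᶠ n : ℕ in atTop, uniformSphere n (discreteProjection ⁻¹' C) ≤
      ENNReal.ofReal (Real.exp (-b * n)) := by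
  set s := 1 - Real.exp (-2 * b')
  have hs1 : s < 1 := by linarith [Real.exp_pos (-2 * b')]
  have hbs : 1 - Real.exp (-2 * b) < s := by
    have : Real.exp (-2 * b') < Real.exp (-2 * b) := Real.exp_lt_exp.2 (by linarith)
    linarith
  have hcomp : IsCompact (unitSeq ∩ limitLaw ⁻¹' C) :=
    isCompact_unitSeq.of_isClosed_subset
      (continuousOn_limitLaw.preimage_isClosed_of_isClosed isClosed_unitSeq hC)
      Set.inter_subset_left
  obtain ⟨m, hm⟩ : ∃ m : ℕ, unitSeq ∩ limitLaw ⁻¹' C ⊆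
      {α | s < ∑ k ∈ Finset.range m, α k ^ 2} := by
    refine hcomp.elim_directed_cover
      (fun m : ℕ => {α : ℕ → ℝ | s < ∑ k ∈ Finset.range m, α k ^ 2})
      (fun m => isOpen_lt (by fun_prop) (by fun_prop)) ?_ ?_
    · rintro α ⟨hα, hαC⟩
      have hlt : s < ∑' k, α k ^ 2 := by
        -- Sequences of norm `1` carry no finite rate but exceed `s` since `s < 1`.
        rcases (unitSeq_tsum_le hα).eq_or_lt with h | h
        · rw [h]; exact hs1
        · have hadm := admissible_of_mem_unitSeq hα h
          have := hI α hadm hαC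
          rw [← not_le, seqRate_le_iff hadm, not_le] at this
          exact this
      obtain ⟨m, hm⟩ :=
        ((unitSeq_summable hα).hasSum.tendsto_sum_nat.eventually_const_lt hlt).exists
      exact Set.mem_iUnion.2 ⟨m, hm⟩
    · refine Monotone.directed_le fun i j hij α hα => ?_
      change s < _ at hα
      exact lt_of_lt_of_le hα (Finset.sum_le_sum_of_subset_of_nonneg
        (Finset.range_subset_range.2 hij) fun _ _ _ => sq_nonneg _)
  filter_upwards [eventually_uniformSphere_sortAbs_le hb hbs hs1 m] with n hn
  refine le_trans (measure_mono_ae ?_) hn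
  filter_upwards [ae_norm_eq_one_uniformSphere] with θ hθ hθ2
  have h1 : sortAbs θ ∈ unitSeq ∩ limitLaw ⁻¹' C := by
    refine ⟨sortAbs_mem_unitSeq hθ, ?_⟩
    change limitLaw (sortAbs θ) ∈ C
    rw [limitLaw_sortAbs hθ]
    exact hθ2
  exact (hm h1).le

lemma inv_mul_log_eq_div (u : ℕ → ℝ≥0∞) (n : ℕ) :
    ((((n : ℝ))⁻¹ : ℝ) : EReal) * ENNReal.log (u n) = ENNReal.log (u n) / n := by
  rw [EReal.div_eq_inv_mul, EReal.coe_inv]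
  rfl

lemma ereal_exp_mul_natCast (b : ℝ) (n : ℕ) :
    EReal.exp ((b : EReal) * n) = ENNReal.ofReal (Real.exp (b * n)) := by
  rw [← EReal.exp_coe]
  rfl

lemma neg_cubeRate_le_expGrowthInf {ν : ProbabilityMeasure ℝ} {U : Set (ProbabilityMeasure ℝ)}
    (hU : IsOpen U) (hν : ν ∈ U) :
    -(cubeRate ν : EReal) ≤
      ExpGrowth.expGrowthInf fun n => uniformSphere n (discreteProjection ⁻¹' U) := by
  by_cases h : ∃ α : ℕ → ℝ, Admissible α ∧ ν = limitLaw α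
  · obtain ⟨α, hα, rfl⟩ := h
    rw [cubeRate_limitLaw hα, EReal.coe_ennreal_ofReal, max_eq_left (seqRate_nonneg hα),
      ExpGrowth.le_expGrowthInf_iff]
    intro b hb
    induction b using EReal.rec with
    | bot =>
      -- Positivity of `n` matters: `⊥ * 0 = 0` in `EReal`.
      filter_upwards [eventually_ge_atTop 1] with n hn
      rw [EReal.bot_mul_of_pos (by exact_mod_cast hn), EReal.exp_bot]
      exact zero_le
    | coe b =>
      rw [← EReal.coe_neg, EReal.coe_lt_coe_iff] at hb
      have := eventually_le_uniformSphere_preimage hα hU hν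
        (ε := -b - seqRate α) (by linarith)
      filter_upwards [this] with n hn
      rw [ereal_exp_mul_natCast]
      convert hn using 4
      ring
    | top => exact absurd hb (not_lt.2 le_top)
  · rw [cubeRate_eq_top h]
    simp

lemma expGrowthSup_le_neg_iInf_cubeRate {C : Set (ProbabilityMeasure ℝ)} (hC : IsClosed C) :
    (ExpGrowth.expGrowthSup fun n => uniformSphere n (discreteProjection ⁻¹' C)) ≤
      -(⨅ ν ∈ C, (cubeRate ν : EReal)) := by
  rw [ExpGrowth.expGrowthSup_le_iff]
  intro b hb
  -- For `b ≥ 0` the bound by total mass is enough; only negative `b` needs the exponential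
  -- estimate.
  rcases le_or_gt 0 b with hb0 | hb0
  · filter_upwards [eventually_ge_atTop 1] with n hn
    have : IsProbabilityMeasure (uniformSphere n) := by
      rw [uniformSphere_eq_map_normalize hn]
      exact Measure.isProbabilityMeasure_map measurable_normalize.aemeasurable
    refine prob_le_one.trans ?_
    rw [← EReal.exp_zero]
    exact EReal.exp_monotone (mul_nonneg hb0 (by exact_mod_cast Nat.zero_le n))
  · induction b using EReal.rec with
    | bot => exact absurd hb not_lt_bot
    | top => exact absurd hb0 (not_lt.2 le_top)
    | coe b =>
      have hb1 : b < 0 := by exact_mod_cast hb0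
      have hb2 : ((-b : ℝ) : EReal) < ⨅ ν ∈ C, (cubeRate ν : EReal) := by
        rw [EReal.coe_neg]
        exact EReal.neg_lt_comm.1 hb
      -- The intermediate level `b'` supplies the strict gap consumed by polynomial factors.
      obtain ⟨b', hbb', hb'⟩ := EReal.lt_iff_exists_real_btwn.1 hb2
      have h := eventually_uniformSphere_preimage_le hC (b := -b) (b' := b') (by linarith)
        (by exact_mod_cast hbb') fun α hα hαC => by
          have h1 : (b' : EReal) < cubeRate (limitLaw α) := hb'.trans_le (iInf₂_le _ hαC)
          rw [cubeRate_limitLaw hα, EReal.coe_ennreal_ofReal,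
            max_eq_left (seqRate_nonneg hα)] at h1
          exact_mod_cast h1
      filter_upwards [h] with n hn
      rw [ereal_exp_mul_natCast]
      simpa using hn

end CubeLDP

end

/-! ### Transfer to arbitrary random vectors with uniform law -/

theorem theoremB {Ω : ℕ → Type*} [∀ n, MeasurableSpace (Ω n)]
    (P : ∀ n, Measure (Ω n)) [∀ n, IsProbabilityMeasure (P n)]
    (Θ : ∀ n, Ω n → EuclideanSpace ℝ (Fin n))
    (hmeas : ∀ n, 1 ≤ n → Measurable (Θ n))
    (hlaw : ∀ n, 1 ≤ n → (P n).map (Θ n) = CubeLDP.uniformSphere n) :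
    (∀ α : ℕ → ℝ, CubeLDP.Admissible α →
      ∀ᵐ ω ∂CubeLDP.jointLaw,
        ∃ x : ℝ, Tendsto (fun m => CubeLDP.partialSum α m ω.2) atTop (𝓝 x)) ∧
    ∃ I : ProbabilityMeasure ℝ → ℝ≥0∞,
      (∀ α : ℕ → ℝ, CubeLDP.Admissible α →
        (I (CubeLDP.limitLaw α) : EReal) =
          ((-(1 / 2) * Real.log (1 - ∑' k, α k ^ 2) : ℝ) : EReal)) ∧
      (∀ ν : ProbabilityMeasure ℝ,
        (¬ ∃ α : ℕ → ℝ, CubeLDP.Admissible α ∧ ν = CubeLDP.limitLaw α) → I ν = ⊤) ∧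
      CubeLDP.IsGoodRateFunction I ∧
      CubeLDP.SatisfiesLDP P (fun n ω => CubeLDP.discreteProjection (Θ n ω))
        (fun n => (n : ℝ)) I := by
  have hproj : ∀ n, Measurable[_, borel (ProbabilityMeasure ℝ)]
      (CubeLDP.discreteProjection : EuclideanSpace ℝ (Fin n) → ProbabilityMeasure ℝ) := fun n => by
    have h := (CubeLDP.continuous_discreteProjection n).borel_measurable
    rwa [← BorelSpace.measurable_eq (α := EuclideanSpace ℝ (Fin n))] at h
  have hprob : ∀ A : Set (ProbabilityMeasure ℝ), MeasurableSet[borel (ProbabilityMeasure ℝ)] A →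
      ∀ n, 1 ≤ n → P n ((fun ω => CubeLDP.discreteProjection (Θ n ω)) ⁻¹' A) =
        CubeLDP.uniformSphere n (CubeLDP.discreteProjection ⁻¹' A) := by
    intro A hA n hn
    rw [← hlaw n hn, Measure.map_apply (hmeas n hn) (hproj n hA)]
    rfl
  refine ⟨fun α hα => CubeLDP.ae_tendsto_partialSum_jointLaw hα.summable, CubeLDP.cubeRate,
    fun α hα => ?_, fun ν hν => CubeLDP.cubeRate_eq_top hν, CubeLDP.isGoodRateFunction_cubeRate, ?_⟩
  · rw [CubeLDP.cubeRate_limitLaw hα, EReal.coe_ennreal_ofReal,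
      max_eq_left (CubeLDP.seqRate_nonneg hα)]
    rfl
  refine ⟨fun n hn => (hproj n).comp (hmeas n hn), fun n hn => by exact_mod_cast hn,
    fun m n _ hmn => by exact_mod_cast hmn, tendsto_natCast_atTop_atTop,
    CubeLDP.lowerSemicontinuous_cubeRate, fun A hA => ?_, fun A hA => ?_⟩
  -- The index `0`, where nothing is assumed about the law, is discarded in passing to exponential
  -- growth rates.
  · have e : liminf (fun n : ℕ => (((n : ℝ)⁻¹ : ℝ) : EReal) *
        ENNReal.log (P n ((fun ω => CubeLDP.discreteProjection (Θ n ω)) ⁻¹' A))) atTop =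
        ExpGrowth.expGrowthInf fun n =>
          CubeLDP.uniformSphere n (CubeLDP.discreteProjection ⁻¹' A) := by
      refine liminf_congr ?_
      filter_upwards [eventually_ge_atTop 1] with n hn
      rw [hprob A hA n hn]
      exact CubeLDP.inv_mul_log_eq_div
        (fun n => CubeLDP.uniformSphere n (CubeLDP.discreteProjection ⁻¹' A)) n
    rw [e, EReal.neg_le]
    refine le_iInf₂ fun ν hν => EReal.neg_le.1 ?_
    refine (CubeLDP.neg_cubeRate_le_expGrowthInf isOpen_interior hν).trans ?_
    exact ExpGrowth.expGrowthInf_monotone fun n =>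
      measure_mono (Set.preimage_mono interior_subset)
  · have e : limsup (fun n : ℕ => (((n : ℝ)⁻¹ : ℝ) : EReal) *
        ENNReal.log (P n ((fun ω => CubeLDP.discreteProjection (Θ n ω)) ⁻¹' A))) atTop =
        ExpGrowth.expGrowthSup fun n =>
          CubeLDP.uniformSphere n (CubeLDP.discreteProjection ⁻¹' A) := by
      refine limsup_congr ?_
      filter_upwards [eventually_ge_atTop 1] with n hn
      rw [hprob A hA n hn]
      exact CubeLDP.inv_mul_log_eq_div
        (fun n => CubeLDP.uniformSphere n (CubeLDP.discreteProjection ⁻¹' A)) n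
    rw [e]
    refine le_trans ?_ (CubeLDP.expGrowthSup_le_neg_iInf_cubeRate isClosed_closure)
    exact ExpGrowth.expGrowthSup_monotone fun n =>
      measure_mono (Set.preimage_mono subset_closure)
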